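/- Consider a network with arcs $I_i=(0,L_i)$, $i\in\mathcal M$ ($\mathcal M$ finite, $L_i>0$), where $\mathcal M$ is the disjoint union of non-empty sets $\mathcal I$ (incoming arcs) and $\mathcal O$ (outgoing arcs). The inner node $N$ is the point $x=L_i$ of $I_i$ if $i\in\mathcal I$ and the point $x=0$ if $i\in\mathcal O$; write $w_i(N)$ for the value of $w_i$ there. Norms of functions $f=(f_i)_{i\in\mathcal M}$ on the network are sums over $i$ of the norms of the $f_i$; $W^{k,1}(\mathcal A)$, $L^1(\mathcal A)$, $BV(\mathcal A)$, $BV(\mathcal A\times(0,T))$ denote the spaces of $f$ with $f_i$ in $W^{k,1}(I_i)$, $L^1(I_i)$, $BV(I_i)$, $BV(I_i\times(0,T))$, and the $BV$ norm is the $L^1$ norm plus the total variation. Let $\lambda_i>0$, $K_{ij}=K_{ji}\ge 0$ ($i,j\in\mathcal M$), $\beta_i=1$ for $i\in\mathcal I$ and $\beta_i=-1$ for $i\in\mathcal O$, and assume that for every $i\in\mathcal I$ there is $j\in\mathcal O$ with $K_{ij}>0$. Let $B_i\in\mathbb R$ ($i\in\mathcal I$), let $u_0\in BV(\mathcal A)$,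 and let $(\epsilon_n)_{n\in\mathbb N}$ be a decreasing sequence of positive numbers with $\epsilon_n\to0$. Let $u_0^{\epsilon_n}\in W^{2,1}(\mathcal A)$ satisfy, for every $n$, $$u^{\epsilon_n}_{0i}(0)=B_i\ (i\in\mathcal I),\qquad \beta_i\bigl(-\lambda_i u^{\epsilon_n}_{0i}(N)+\epsilon_n (u^{\epsilon_n}_{0i})'(N)\bigr)=\sum_{j\in\mathcal M}K_{ij}\bigl(u^{\epsilon_n}_{0j}(N)-u^{\epsilon_n}_{0i}(N)\bigr)\ (i\in\mathcal M),$$ and suppose that $u_0^{\epsilon_n}\to u_0$ in $L^1(\mathcal A)$, $\sup_n\|(u_0^{\epsilon_n})'\|_{L^1(\mathcal A)}<\infty$ and $\sup_n\epsilon_n\|u_0^{\epsilon_n}\|_{W^{2,1}(\mathcal A)}<\infty$. Let $T>0$ and, for every $n$, let $u^{\epsilon_n}\in C([0,T];W^{2,1}(\mathcal A))\cap C^1([0,T];L^1(\mathcal A))$ be the solution of $$\begin{cases} \partial_t u_i^{\epsilon_n}=-\lambda_i\,\partial_x u_i^{\epsilon_n}+\epsilon_n\,\partial_{xx}u_i^{\epsilon_n}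 & x\in I_i,\ t\in[0,T],\ i\in\mathcal M,\\ u_i^{\epsilon_n}(x,0)=u_{0i}^{\epsilon_n}(x) & x\in I_i,\ i\in\mathcal M,\\ \beta_i\bigl(-\lambda_i u_i^{\epsilon_n}(N,t)+\epsilon_n\partial_x u_i^{\epsilon_n}(N,t)\bigr)=\sum_{j\in\mathcal M}K_{ij}\bigl(u_j^{\epsilon_n}(N,t)-u_i^{\epsilon_n}(N,t)\bigr) & t\in[0,T],\ i\in\mathcal M,\\ u_i^{\epsilon_n}(0,t)=B_i\ (i\in\mathcal I),\quad u_i^{\epsilon_n}(L_i,t)=u_{0i}^{\epsilon_n}(L_i)\ (i\in\mathcal O) & t\in[0,T].\end{cases}$$ Then $u^{\epsilon_n}\in BV(\mathcal A\times(0,T))$ for every $n$, and $$\sup_{n\in\mathbb N}\|u^{\epsilon_n}\|_{BV(\mathcal A\times(0,T))}<+\infty .$$ -/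

import Mathlib

open MeasureTheory Set Filter Topology
open scoped ENNReal

/-- A `C¹` function on `ℝ` with compact support in the open interval `(0, ℓ)`. -/
structure IsTest1 (ℓ : ℝ) (φ : ℝ → ℝ) : Prop where
  contDiff : ContDiff ℝ 1 φ
  hasCompactSupport : HasCompactSupport φ
  tsupport_subset : tsupport φ ⊆ Ioo 0 ℓ

/-- `g` is the weak derivative of `f` on the interval `(0, ℓ)`. -/
def HasWeakDeriv (ℓ : ℝ) (f g : ℝ → ℝ) : Prop :=
  ∀ φ : ℝ → ℝ, IsTest1 ℓ φ →
    ∫ x in Ioo 0 ℓ, f x * deriv φ x = -∫ x in Ioo 0 ℓ, g x * φ x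

/-- An element of the Sobolev space `W^{2,1}(0, ℓ)`, given by its `C¹([0, ℓ])` representative
`toFun`, the continuous representative `der` of the first weak derivative, and the second weak
derivative `der2`, an integrable function.  The boundary values of the function and of its
derivative are the values of `toFun` and `der` at `0` and `ℓ`. -/
structure W21 (ℓ : ℝ) where
  toFun : ℝ → ℝ
  der : ℝ → ℝ
  der2 : ℝ → ℝ
  continuousOn_toFun : ContinuousOn toFun (Icc 0 ℓ)
  continuousOn_der : ContinuousOn der (Icc 0 ℓ)
  integrableOn_der2 : IntegrableOn der2 (Ioo 0 ℓ)
  hasWeakDeriv_toFun : HasWeakDeriv ℓ toFun der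
  hasWeakDeriv_der : HasWeakDeriv ℓ der der2

/-- The Banach space `L¹(0, ℓ)`. -/
abbrev L1Arc (ℓ : ℝ) : Type := Lp ℝ 1 (volume.restrict (Ioo (0 : ℝ) ℓ))

namespace W21

variable {ℓ : ℝ}

theorem integrableOn_toFun (f : W21 ℓ) : IntegrableOn f.toFun (Ioo 0 ℓ) :=
  (f.continuousOn_toFun.integrableOn_Icc).mono_set Ioo_subset_Icc_self

theorem integrableOn_der (f : W21 ℓ) : IntegrableOn f.der (Ioo 0 ℓ) :=
  (f.continuousOn_der.integrableOn_Icc).mono_set Ioo_subset_Icc_self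

/-- The class of the function in `L¹(0, ℓ)`. -/
noncomputable def toL1 (f : W21 ℓ) : L1Arc ℓ := f.integrableOn_toFun.toL1 f.toFun

/-- The class of the first derivative in `L¹(0, ℓ)`. -/
noncomputable def derL1 (f : W21 ℓ) : L1Arc ℓ := f.integrableOn_der.toL1 f.der

/-- The class of the second derivative in `L¹(0, ℓ)`. -/
noncomputable def der2L1 (f : W21 ℓ) : L1Arc ℓ := f.integrableOn_der2.toL1 f.der2

/-- The `W^{2,1}(0, ℓ)` norm. -/
noncomputable def norm (f : W21 ℓ) : ℝ := ‖f.toL1‖ + ‖f.derL1‖ + ‖f.der2L1‖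

end W21

/-- The total variation of `f` on the interval `(0, ℓ)`: the supremum of `∫ f φ'` over
`φ ∈ C¹_c(0, ℓ)` with `|φ| ≤ 1`. -/
noncomputable def totalVariation1 (ℓ : ℝ) (f : ℝ → ℝ) : ℝ≥0∞ :=
  ⨆ (φ : ℝ → ℝ) (_ : IsTest1 ℓ φ) (_ : ∀ x, |φ x| ≤ 1),
    ENNReal.ofReal (∫ x in Ioo 0 ℓ, f x * deriv φ x)

/-- `f ∈ BV(0, ℓ)`. -/
def MemBV1 (ℓ : ℝ) (f : ℝ → ℝ) : Prop :=
  IntegrableOn f (Ioo 0 ℓ) ∧ totalVariation1 ℓ f < ⊤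

/-- A `C¹` function on the plane with compact support in `U`. -/
structure IsTest2 (U : Set (ℝ × ℝ)) (φ : ℝ × ℝ → ℝ) : Prop where
  contDiff : ContDiff ℝ 1 φ
  hasCompactSupport : HasCompactSupport φ
  tsupport_subset : tsupport φ ⊆ U

/-- The total variation of `f` on an open set `U` of the plane: the supremum of `∫_U f div Φ` over
the vector fields `Φ = (φ, ψ) ∈ C¹_c(U; ℝ²)` with Euclidean norm at most one everywhere. -/
noncomputable def totalVariation2 (U : Set (ℝ × ℝ)) (f : ℝ × ℝ → ℝ) : ℝ≥0∞ :=
  ⨆ (φ : ℝ × ℝ → ℝ) (ψ : ℝ × ℝ → ℝ) (_ : IsTest2 U φ) (_ : IsTest2 U ψ)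
    (_ : ∀ p, φ p ^ 2 + ψ p ^ 2 ≤ 1),
    ENNReal.ofReal (∫ p in U, f p * (fderiv ℝ φ p (1, 0) + fderiv ℝ ψ p (0, 1)))

/-- `f ∈ BV(U)`, for an open set `U` of the plane. -/
def MemBV2 (U : Set (ℝ × ℝ)) (f : ℝ × ℝ → ℝ) : Prop :=
  IntegrableOn f U ∧ totalVariation2 U f < ⊤

/-- The `BV(U)` norm, the sum of the `L¹(U)` norm and the total variation. -/
noncomputable def bvNorm2 (U : Set (ℝ × ℝ)) (f : ℝ × ℝ → ℝ) : ℝ≥0∞ :=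
  eLpNorm f 1 (volume.restrict U) + totalVariation2 U f

/-- A starshaped network with arcs `(0, length i)`.  The arcs in `incoming` enter the inner node
(at `x = length i`) and the other arcs leave it (at `x = 0`); both kinds occur. -/
structure StarNetwork (ι : Type*) where
  length : ι → ℝ
  length_pos : ∀ i, 0 < length i
  incoming : Finset ι
  exists_incoming : ∃ i, i ∈ incoming
  exists_outgoing : ∃ i, i ∉ incoming

namespace StarNetwork

variable {ι : Type*} [DecidableEq ι] (N : StarNetwork ι)

/-- The coordinate of the inner node on the arc `i`. -/
noncomputable def inner (i : ι) : ℝ := if i ∈ N.incoming then N.length i else 0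

/-- The sign `β i`: `1` on incoming arcs and `-1` on outgoing arcs. -/
noncomputable def beta (i : ι) : ℝ := if i ∈ N.incoming then 1 else -1

/-- The space-time cylinder `(0, length i) × (0, T)` over the arc `i`. -/
def cylinder (i : ι) (T : ℝ) : Set (ℝ × ℝ) := Ioo 0 (N.length i) ×ˢ Ioo 0 T

/-- The transmission conditions at the inner node, with velocities `lam`, coefficients `K` and
viscosity `ε`. -/
def Transmission [Fintype ι] (lam : ι → ℝ) (K : ι → ι → ℝ) (ε : ℝ)
    (w : ∀ i, W21 (N.length i)) : Prop :=
  ∀ i, N.beta i * (-lam i * (w i).toFun (N.inner i) + ε * (w i).der (N.inner i)) =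
    ∑ j, K i j * ((w j).toFun (N.inner j) - (w i).toFun (N.inner i))

/-- The set `D_ε` of admissible initial data: the transmission conditions hold, and the value at
the outer node of each incoming arc `i` is `B i`. -/
structure MemD [Fintype ι] (lam : ι → ℝ) (K : ι → ι → ℝ) (B : ι → ℝ) (ε : ℝ)
    (w : ∀ i, W21 (N.length i)) : Prop where
  outer : ∀ i ∈ N.incoming, (w i).toFun 0 = B i
  transmission : N.Transmission lam K ε w

/-- The sequence `v n` approximates `v₀`: each `v n` lies in `D_{ε n}`, `v n → v₀` in `L¹`, the
`L¹` norms of the derivatives are bounded, and `ε n ‖v n‖_{W^{2,1}}` is bounded. -/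
structure Approximates [Fintype ι] (lam : ι → ℝ) (K : ι → ι → ℝ) (B : ι → ℝ) (ε : ℕ → ℝ)
    (v₀ : ι → ℝ → ℝ) (v : ℕ → ∀ i, W21 (N.length i)) : Prop where
  memD : ∀ n, N.MemD lam K B (ε n) (v n)
  tendsto : ∀ i, Tendsto
    (fun n => eLpNorm (fun x => (v n i).toFun x - v₀ i x) 1
      (volume.restrict (Ioo 0 (N.length i)))) atTop (𝓝 0)
  bound_der : ∃ C : ℝ, ∀ n, ∑ i, ‖(v n i).derL1‖ ≤ C
  bound_norm : ∃ C : ℝ, ∀ n, ε n * ∑ i, (v n i).norm ≤ C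

/-- `t ↦ u i t = u_i(·, t)` is a solution on `[0, T]`, of class
`C([0, T]; W^{2,1}) ∩ C¹([0, T]; L¹)`, of the problem with viscosity `ε`, initial datum `v` and
boundary data `B` on the incoming arcs; on an outgoing arc the value at the outer node is that of
the initial datum. -/
structure IsSolution [Fintype ι] (lam : ι → ℝ) (K : ι → ι → ℝ) (B : ι → ℝ) (ε : ℝ)
    (v : ∀ i, W21 (N.length i)) (T : ℝ) (u : ∀ i, ℝ → W21 (N.length i)) : Prop where
  continuous_W21 : ∀ i, ContinuousOn (fun t => (u i t).toL1) (Icc 0 T) ∧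
    ContinuousOn (fun t => (u i t).derL1) (Icc 0 T) ∧
    ContinuousOn (fun t => (u i t).der2L1) (Icc 0 T)
  contDiff_L1 : ∀ i, ContDiffOn ℝ 1 (fun t => (u i t).toL1) (Icc 0 T)
  equation : ∀ i, ∀ t ∈ Icc 0 T,
    derivWithin (fun s => (u i s).toL1) (Icc 0 T) t =
      -(lam i • (u i t).derL1) + ε • (u i t).der2L1
  initial : ∀ i, ∀ x ∈ Ioo 0 (N.length i), (u i 0).toFun x = (v i).toFun x
  transmission : ∀ t ∈ Icc 0 T, N.Transmission lam K ε (fun i => u i t)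
  outer_incoming : ∀ i ∈ N.incoming, ∀ t ∈ Icc 0 T, (u i t).toFun 0 = B i
  outer_outgoing : ∀ i ∉ N.incoming, ∀ t ∈ Icc 0 T,
    (u i t).toFun (N.length i) = (v i).toFun (N.length i)

end StarNetwork

/-! The time derivative is controlled first, by dissipativity in `L¹`, and the space derivative is
then recovered from it at each fixed time.

Time. The difference of a solution and its time translate satisfies homogeneous boundary conditions.
Testing the equation with the sign of the difference (Kato's inequality, `integral_sign_mul_le`)
leaves only node terms, and these cancel because `K` is symmetric and nonnegative
(`sum_integral_sign_mul_nonpos`). So the `L¹` distance between the solution and its translate does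
not increase. Dividing by the time step bounds `‖∂ₜu(t)‖` by `‖∂ₜu(0)‖`, which the assumptions on
the initial data bound uniformly in the viscosity.

Space. For fixed `t` the flux `λu - εu_x` has space derivative `-∂ₜu`, so it oscillates by at most a
constant on each arc. Integrating `εu_x - λu = -flux` with the factor `exp(-λx/ε)` relates node
values, fluxes and outer values. On an incoming arc a nonnegative node value forces the flux to be
bounded above. On an outgoing arc the node value is bounded by the outer value and the flux. A
maximum principle over the arcs (`exists_node_upper_bound`) then bounds the node values; here every
incoming arc needs an outgoing neighbour with `K i j > 0`. The transmission condition bounds the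
node fluxes, hence `ε|u_x|` at the right ends, and the first order equation for `u_x` bounds its
`L¹` norm (`exists_nodeState_bound`).

A function with slices of bounded variation in `x` and Lipschitz in `t` with values in `L¹` has
bounded variation in space-time (`totalVariation2_le`), and all constants are independent of `n`. -/

/-! ### Absolutely continuous functions on an interval. -/

theorem LipschitzWith.comp_absolutelyContinuousOnInterval {k : NNReal} {j f : ℝ → ℝ} {a b : ℝ}
    (hj : LipschitzWith k j) (hf : AbsolutelyContinuousOnInterval f a b) :
    AbsolutelyContinuousOnInterval (fun x => j (f x)) a b := by
  refine squeeze_zero (fun t ↦ Finset.sum_nonneg fun i _ => dist_nonneg) (fun t ↦ ?_)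
    (by simpa using! Tendsto.const_mul (k : ℝ) hf)
  rw [Finset.mul_sum]
  exact Finset.sum_le_sum fun i _ => hj.dist_le_mul _ _

/-- `f` is absolutely continuous on `[0, ℓ]` with derivative `g` almost everywhere. -/
structure IsPrimitive (ℓ : ℝ) (f g : ℝ → ℝ) : Prop where
  ac : AbsolutelyContinuousOnInterval f 0 ℓ
  hasDerivAt : ∀ᵐ x, x ∈ Ioo 0 ℓ → HasDerivAt f (g x) x

namespace IsPrimitive

variable {ℓ : ℝ} {f g F G : ℝ → ℝ}

theorem continuousOn (h : IsPrimitive ℓ f g) (hℓ : 0 < ℓ) : ContinuousOn f (Icc 0 ℓ) := by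
  have := h.ac.continuousOn
  rwa [uIcc_of_le hℓ.le] at this

theorem ae_eq_deriv (h : IsPrimitive ℓ f g) : ∀ᵐ x ∂volume.restrict (Ioo 0 ℓ), deriv f x = g x := by
  rw [ae_restrict_iff' measurableSet_Ioo]
  filter_upwards [h.hasDerivAt] with x hx hm using (hx hm).deriv

theorem integrableOn (h : IsPrimitive ℓ f g) (hℓ : 0 < ℓ) : IntegrableOn g (Ioo 0 ℓ) := by
  have := h.ac.intervalIntegrable_deriv
  rw [intervalIntegrable_iff_integrableOn_Ioo_of_le hℓ.le] at this
  exact this.congr h.ae_eq_deriv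

theorem intervalIntegrable (h : IsPrimitive ℓ f g) (hℓ : 0 < ℓ) :
    IntervalIntegrable g volume 0 ℓ := by
  rw [intervalIntegrable_iff_integrableOn_Ioo_of_le hℓ.le]
  exact h.integrableOn hℓ

theorem intervalIntegral_eq (h : IsPrimitive ℓ f g) {x y : ℝ} (hx : 0 ≤ x) (hxy : x ≤ y)
    (hy : y ≤ ℓ) : ∫ s in x..y, g s = f y - f x := by
  have hac : AbsolutelyContinuousOnInterval f x y := h.ac.mono (by
    rw [uIcc_of_le hxy, uIcc_of_le (hx.trans (hxy.trans hy))]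
    exact Icc_subset_Icc hx hy)
  rw [← hac.integral_deriv_eq_sub]
  apply intervalIntegral.integral_congr_ae
  have hne : ∀ᵐ s : ℝ, s ≠ ℓ := by simp [ae_iff, measure_singleton]
  filter_upwards [h.hasDerivAt, hne] with s hs hsℓ hm
  rw [uIoc_of_le hxy] at hm
  exact (hs ⟨hx.trans_lt hm.1, lt_of_le_of_ne (hm.2.trans hy) hsℓ⟩).deriv.symm

theorem integral_eq (h : IsPrimitive ℓ f g) (hℓ : 0 < ℓ) :
    ∫ x in Ioo 0 ℓ, g x = f ℓ - f 0 := by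
  rw [← integral_Ioc_eq_integral_Ioo, ← intervalIntegral.integral_of_le hℓ.le]
  exact h.intervalIntegral_eq le_rfl hℓ.le le_rfl

theorem abs_sub_le (h : IsPrimitive ℓ f g) (hℓ : 0 < ℓ) {x y : ℝ} (hx : x ∈ Icc 0 ℓ)
    (hy : y ∈ Icc 0 ℓ) : |f y - f x| ≤ ∫ s in Ioo 0 ℓ, |g s| := by
  wlog hxy : x ≤ y generalizing x y
  · rw [abs_sub_comm]
    exact this hy hx (le_of_not_ge hxy)
  rw [← h.intervalIntegral_eq hx.1 hxy hy.2, ← integral_Ioc_eq_integral_Ioo,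
    intervalIntegral.integral_of_le hxy]
  refine (abs_integral_le_integral_abs).trans ?_
  refine setIntegral_mono_set ?_ (ae_of_all _ fun _ => abs_nonneg _)
    (Ioc_subset_Ioc hx.1 hy.2).eventuallyLE
  have := (h.integrableOn hℓ).abs
  rwa [IntegrableOn, ← restrict_Ioo_eq_restrict_Ioc]

theorem abs_le (h : IsPrimitive ℓ f g) (hℓ : 0 < ℓ) {y : ℝ} (hy : y ∈ Icc 0 ℓ) :
    |f y| ≤ ℓ⁻¹ * (∫ s in Ioo 0 ℓ, |f s|) + ∫ s in Ioo 0 ℓ, |g s| := by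
  have hint : IntegrableOn f (Ioo 0 ℓ) :=
    (h.continuousOn hℓ).integrableOn_Icc.mono_set Ioo_subset_Icc_self
  have hvol : volume.real (Ioo 0 ℓ) = ℓ := by simp [hℓ.le]
  have hfin : volume (Ioo 0 ℓ) ≠ ∞ := by simp
  -- Average over `s` the bound of `|f y| - |f s|` by the integral of `|g|`.
  have : ∫ s in Ioo 0 ℓ, (|f y| - ∫ r in Ioo 0 ℓ, |g r|) ≤ ∫ s in Ioo 0 ℓ, |f s| := by
    refine setIntegral_mono_on (by simp) hint.abs measurableSet_Ioo fun s hs => ?_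
    have h1 := h.abs_sub_le hℓ (Ioo_subset_Icc_self hs) hy
    have h2 := abs_sub_abs_le_abs_sub (f y) (f s)
    linarith
  rw [setIntegral_const, hvol, smul_eq_mul] at this
  have h3 : ℓ⁻¹ * (ℓ * (|f y| - ∫ r in Ioo 0 ℓ, |g r|)) ≤ ℓ⁻¹ * ∫ s in Ioo 0 ℓ, |f s| :=
    mul_le_mul_of_nonneg_left this (by positivity)
  rw [inv_mul_cancel_left₀ hℓ.ne'] at h3
  linarith

theorem sub (h : IsPrimitive ℓ f g) (H : IsPrimitive ℓ F G) :
    IsPrimitive ℓ (fun x => f x - F x) (fun x => g x - G x) where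
  ac := h.ac.sub H.ac
  hasDerivAt := by
    filter_upwards [h.hasDerivAt, H.hasDerivAt] with x hx Hx hm using (hx hm).sub (Hx hm)

theorem const_mul (h : IsPrimitive ℓ f g) (c : ℝ) :
    IsPrimitive ℓ (fun x => c * f x) (fun x => c * g x) where
  ac := h.ac.const_mul c
  hasDerivAt := by
    filter_upwards [h.hasDerivAt] with x hx hm using (hx hm).const_mul c

theorem mul (h : IsPrimitive ℓ f g) (H : IsPrimitive ℓ F G) :
    IsPrimitive ℓ (fun x => f x * F x) (fun x => g x * F x + f x * G x) where
  ac := h.ac.mul H.ac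
  hasDerivAt := by
    filter_upwards [h.hasDerivAt, H.hasDerivAt] with x hx Hx hm using (hx hm).mul (Hx hm)

theorem comp {k : NNReal} {j j' : ℝ → ℝ} (hj : LipschitzWith k j)
    (hj' : ∀ r, HasDerivAt j (j' r) r) (h : IsPrimitive ℓ f g) :
    IsPrimitive ℓ (fun x => j (f x)) (fun x => j' (f x) * g x) where
  ac := hj.comp_absolutelyContinuousOnInterval h.ac
  hasDerivAt := by
    filter_upwards [h.hasDerivAt] with x hx hm using (hj' (f x)).comp x (hx hm)

theorem of_contDiff (hf : ContDiff ℝ 1 f) : IsPrimitive ℓ f (deriv f) where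
  ac := hf.contDiffOn.absolutelyContinuousOnInterval
  hasDerivAt := ae_of_all _ fun x _ => (hf.differentiable (by simp) x).hasDerivAt

theorem intervalIntegral (hg : IntervalIntegrable g volume 0 ℓ) :
    IsPrimitive ℓ (fun x => ∫ s in (0 : ℝ)..x, g s) g where
  ac := hg.absolutelyContinuousOnInterval_intervalIntegral (by simp)
  hasDerivAt := by
    filter_upwards [hg.ae_hasDerivAt_integral] with x hx hm
    exact hx (Ioo_subset_Icc_self.trans Icc_subset_uIcc hm) 0 (by simp)

/-- The absolute value of an absolutely continuous function. -/
theorem abs (h : IsPrimitive ℓ f g) :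
    IsPrimitive ℓ (fun x => |f x|) (fun x => SignType.sign (f x) * g x) := by
  have hl : LipschitzWith 1 (fun x : ℝ => |x|) := LipschitzWith.of_dist_le_mul fun x y => by
    simpa [Real.dist_eq] using abs_abs_sub_abs_le_abs_sub x y
  have hac := hl.comp_absolutelyContinuousOnInterval h.ac
  refine ⟨hac, ?_⟩
  filter_upwards [h.hasDerivAt, hac.ae_differentiableAt] with x hx hd hm
  have hd := (hd (Ioo_subset_Icc_self.trans Icc_subset_uIcc hm)).hasDerivAt
  rcases eq_or_ne (f x) 0 with h0 | h0
  -- At a zero of `f` the function `|f|` has a minimum, so its derivative, where it exists, is `0`;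
  -- this matches the convention `sign 0 = 0`.
  · have hmin : IsLocalMin (fun x => |f x|) x :=
      Filter.Eventually.of_forall fun y => by simp [h0]
    rw [hmin.deriv_eq_zero] at hd
    simpa [h0] using hd
  · exact (hasDerivAt_abs h0).comp x (hx hm)

end IsPrimitive

/-! ### Weak derivatives and the lemma of du Bois-Reymond. -/

namespace IsTest1

variable {ℓ : ℝ} {φ : ℝ → ℝ}

theorem apply_eq_zero (h : IsTest1 ℓ φ) {x : ℝ} (hx : x ∉ Ioo 0 ℓ) : φ x = 0 :=
  image_eq_zero_of_notMem_tsupport fun hm => hx (h.tsupport_subset hm)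

end IsTest1

theorem IsPrimitive.hasWeakDeriv {ℓ : ℝ} {f g : ℝ → ℝ} (h : IsPrimitive ℓ f g) (hℓ : 0 < ℓ) :
    HasWeakDeriv ℓ f g := by
  intro φ hφ
  have H := h.mul (of_contDiff (ℓ := ℓ) hφ.contDiff)
  have h0 := H.integral_eq hℓ
  have hφc := hφ.contDiff.continuous
  have hd : Continuous (deriv φ) := hφ.contDiff.continuous_deriv le_rfl
  have i1 : IntegrableOn (fun x => g x * φ x) (Ioo 0 ℓ) := by
    have := (h.intervalIntegrable hℓ).mul_continuousOn hφc.continuousOn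
    rwa [intervalIntegrable_iff_integrableOn_Ioo_of_le hℓ.le] at this
  have i2 : IntegrableOn (fun x => f x * deriv φ x) (Ioo 0 ℓ) :=
    (((h.continuousOn hℓ).mul hd.continuousOn).integrableOn_Icc).mono_set Ioo_subset_Icc_self
  rw [integral_add i1 i2, hφ.apply_eq_zero (x := ℓ) (by simp),
    hφ.apply_eq_zero (x := 0) (by simp)] at h0
  linarith

theorem IsCompact.exists_Icc_of_subset_Ioo {S : Set ℝ} {ℓ : ℝ} (hS : IsCompact S)
    (hsub : S ⊆ Ioo 0 ℓ) (hℓ : 0 < ℓ) : ∃ a b, 0 < a ∧ b < ℓ ∧ a ≤ b ∧ S ⊆ Icc a b := by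
  -- The midpoint is inserted so that the minimum and maximum exist even when `S` is empty.
  have hS' : IsCompact (insert (ℓ / 2) S) := hS.insert _
  have hsub' : insert (ℓ / 2) S ⊆ Ioo 0 ℓ :=
    insert_subset ⟨by linarith, by linarith⟩ hsub
  obtain ⟨a, ha, ha'⟩ := hS'.exists_isLeast (insert_nonempty _ _)
  obtain ⟨b, hb, hb'⟩ := hS'.exists_isGreatest (insert_nonempty _ _)
  exact ⟨a, b, (hsub' ha).1, (hsub' hb).2, ha' hb, fun x hx =>
    ⟨ha' (mem_insert_of_mem _ hx), hb' (mem_insert_of_mem _ hx)⟩⟩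

/-- The primitive of a continuous function of mean zero with compact support in `(0, ℓ)` is a test
function. -/
theorem isTest1_intervalIntegral {ℓ : ℝ} (hℓ : 0 < ℓ) {ρ : ℝ → ℝ} (hρ : Continuous ρ)
    (hc : HasCompactSupport ρ) (hs : tsupport ρ ⊆ Ioo 0 ℓ) (h0 : ∫ x, ρ x = 0) :
    IsTest1 ℓ (fun x => ∫ s in (0 : ℝ)..x, ρ s) := by
  obtain ⟨a, b, ha, hb, hab, hsub⟩ := hc.isCompact.exists_Icc_of_subset_Ioo hs hℓ
  have hz : ∀ x, x ∉ Icc a b → ρ x = 0 := fun x hx =>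
    image_eq_zero_of_notMem_tsupport fun hm => hx (hsub hm)
  have hd : ∀ x, HasDerivAt (fun x => ∫ s in (0 : ℝ)..x, ρ s) (ρ x) x := fun x =>
    intervalIntegral.integral_hasDerivAt_right (hρ.intervalIntegrable _ _)
      (hρ.stronglyMeasurableAtFilter _ _) hρ.continuousAt
  have hderiv : deriv (fun x => ∫ s in (0 : ℝ)..x, ρ s) = ρ := funext fun x => (hd x).deriv
  have hsupp : tsupport (fun x => ∫ s in (0 : ℝ)..x, ρ s) ⊆ Icc a b := by
    refine closure_minimal (fun x hx => ?_) isClosed_Icc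
    by_contra hm
    apply hx
    rcases lt_or_ge x a with h | h
    · apply intervalIntegral.integral_zero_ae
      refine ae_of_all _ fun s hs => hz s fun hs' => ?_
      have : s ≤ max 0 x := hs.2
      rcases max_cases 0 x with h1 | h1 <;> linarith [hs'.1]
    · have hbx : b < x := lt_of_not_ge fun h' => hm ⟨h, h'⟩
      change ∫ s in (0 : ℝ)..x, ρ s = 0
      rw [← h0]
      apply intervalIntegral.integral_eq_integral_of_support_subset
      intro s hs
      have := hsub (subset_tsupport _ hs)
      exact ⟨by linarith [this.1], by linarith [this.2]⟩
  refine ⟨?_, ?_, hsupp.trans fun x hx => ⟨by linarith [hx.1], by linarith [hx.2]⟩⟩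
  · rw [contDiff_one_iff_deriv, hderiv]
    exact ⟨fun x => (hd x).differentiableAt, hρ⟩
  · exact HasCompactSupport.of_support_subset_isCompact isCompact_Icc
      ((subset_tsupport _).trans hsupp)

theorem setIntegral_mul_eq_of_tsupport_subset {S : Set ℝ} {χ : ℝ → ℝ}
    (hχ : tsupport χ ⊆ S) (f : ℝ → ℝ) : ∫ x in S, f x * χ x = ∫ x, f x * χ x := by
  apply setIntegral_eq_integral_of_forall_compl_eq_zero
  intro x hx
  rw [image_eq_zero_of_notMem_tsupport fun hm => hx (hχ hm), mul_zero]

/-- The lemma of du Bois-Reymond. -/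
theorem eqOn_const_of_hasWeakDeriv_zero {ℓ : ℝ} (hℓ : 0 < ℓ) {f : ℝ → ℝ}
    (hf : ContinuousOn f (Icc 0 ℓ)) (h : HasWeakDeriv ℓ f 0) :
    ∃ c, ∀ x ∈ Icc 0 ℓ, f x = c := by
  let b : ContDiffBump (ℓ / 2) := ⟨ℓ / 8, ℓ / 4, by positivity, by linarith⟩
  set η : ℝ → ℝ := b.normed volume
  have hηs : tsupport η ⊆ Ioo 0 ℓ := by
    rw [b.tsupport_normed_eq, Real.closedBall_eq_Icc]
    intro x hx
    have h1 : ℓ / 2 - ℓ / 4 ≤ x := hx.1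
    have h2 : x ≤ ℓ / 2 + ℓ / 4 := hx.2
    exact ⟨by linarith, by linarith⟩
  have hηc : Continuous η := b.continuous_normed
  have hηcs : HasCompactSupport η := b.hasCompactSupport_normed
  have hη1 : ∫ x, η x = 1 := b.integral_normed
  have hint : ∀ χ : ℝ → ℝ, Continuous χ → IntegrableOn (fun x => f x * χ x) (Ioo 0 ℓ) :=
    fun χ hχ => ((hf.mul hχ.continuousOn).integrableOn_Icc).mono_set Ioo_subset_Icc_self
  refine ⟨∫ x in Ioo 0 ℓ, f x * η x, ?_⟩
  set c := ∫ x in Ioo 0 ℓ, f x * η x with hc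
  have key : ∀ᵐ x, x ∈ Ioo 0 ℓ → f x - c = 0 := by
    refine isOpen_Ioo.ae_eq_zero_of_integral_contDiff_smul_eq_zero ?_ fun χ hχ hχc hχs => ?_
    · exact (((hf.sub continuousOn_const).integrableOn_Icc).mono_set
        Ioo_subset_Icc_self).locallyIntegrableOn
    · have hχ' := hχ.continuous
      set m := ∫ x, χ x with hm
      -- Subtracting `m η` gives mean zero, so the primitive has compact support and is an
      -- admissible test function. Testing with it yields `∫ f χ = c ∫ χ`.
      have hρs : tsupport (fun x => χ x - m * η x) ⊆ Ioo 0 ℓ :=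
        (tsupport_sub χ (fun x => m * η x)).trans
          (union_subset hχs ((tsupport_mul_subset_right).trans hηs))
      have hρcs : HasCompactSupport (fun x => χ x - m * η x) :=
        hχc.sub (hηcs.mul_left (f := fun _ => m))
      have i1 : Integrable χ := hχ'.integrable_of_hasCompactSupport hχc
      have i2 : Integrable η := hηc.integrable_of_hasCompactSupport hηcs
      have hρc : Continuous (fun x => χ x - m * η x) := by fun_prop
      have htest := isTest1_intervalIntegral hℓ hρc hρcs hρs (by
        rw [integral_sub i1 (i2.const_mul m), integral_const_mul, hη1, mul_one, sub_self])
      have h0 := h _ htest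
      have hderiv : ∀ x, deriv (fun x => ∫ s in (0 : ℝ)..x, (χ s - m * η s)) x = χ x - m * η x :=
        fun x => (intervalIntegral.integral_hasDerivAt_right (hρc.intervalIntegrable _ _)
          (hρc.stronglyMeasurableAtFilter _ _) hρc.continuousAt).deriv
      simp only [hderiv, Pi.zero_apply, zero_mul, integral_zero, neg_zero] at h0
      have h1 : ∫ x in Ioo 0 ℓ, f x * (χ x - m * η x)
          = (∫ x in Ioo 0 ℓ, f x * χ x) - m * c := by
        rw [hc, ← integral_const_mul, ← integral_sub (hint _ hχ') ((hint _ hηc).const_mul m)]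
        congr 1; ext x; ring
      have h2 : ∫ x in Ioo 0 ℓ, c * χ x = c * m := by
        rw [setIntegral_mul_eq_of_tsupport_subset hχs (fun _ => c), integral_const_mul]
      have h3 : ∫ x, χ x • (f x - c) = ∫ x in Ioo 0 ℓ, (f x - c) * χ x := by
        rw [setIntegral_mul_eq_of_tsupport_subset hχs]
        congr 1; ext x; simp [mul_comm]
      have h4 : ∫ x in Ioo 0 ℓ, (f x - c) * χ x
          = (∫ x in Ioo 0 ℓ, f x * χ x) - ∫ x in Ioo 0 ℓ, c * χ x := by
        rw [← integral_sub (hint _ hχ') (i1.integrableOn.const_mul c)]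
        congr 1; ext x; ring
      rw [h3, h4, h2]
      linarith
  have hae : f =ᵐ[volume.restrict (Icc 0 ℓ)] fun _ => c := by
    rw [← restrict_Ioo_eq_restrict_Icc, Filter.EventuallyEq, ae_restrict_iff' measurableSet_Ioo]
    filter_upwards [key] with x hx hm using sub_eq_zero.1 (hx hm)
  exact Measure.eqOn_Icc_of_ae_eq volume hℓ.ne hae hf continuousOn_const

/-- A continuous function with an integrable weak derivative is absolutely continuous. -/
theorem HasWeakDeriv.isPrimitive {ℓ : ℝ} (hℓ : 0 < ℓ) {f g : ℝ → ℝ}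
    (h : HasWeakDeriv ℓ f g) (hf : ContinuousOn f (Icc 0 ℓ)) (hg : IntegrableOn g (Ioo 0 ℓ)) :
    IsPrimitive ℓ f g := by
  have hgi : IntervalIntegrable g volume 0 ℓ := by
    rwa [intervalIntegrable_iff_integrableOn_Ioo_of_le hℓ.le]
  have hP := IsPrimitive.intervalIntegral hgi
  have hPc := hP.continuousOn hℓ
  obtain ⟨c, hc⟩ := eqOn_const_of_hasWeakDeriv_zero hℓ (hf.sub hPc) (by
    intro φ hφ
    have h1 := h φ hφ
    have h2 := hP.hasWeakDeriv hℓ φ hφ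
    have hd : Continuous (deriv φ) := hφ.contDiff.continuous_deriv le_rfl
    have hint : ∀ f : ℝ → ℝ, ContinuousOn f (Icc 0 ℓ) →
        IntegrableOn (fun x => f x * deriv φ x) (Ioo 0 ℓ) := fun f hf =>
      ((hf.mul hd.continuousOn).integrableOn_Icc).mono_set Ioo_subset_Icc_self
    have h3 := integral_sub (hint _ hf) (hint _ hPc)
    simp only [← sub_mul] at h3
    simp [h3, h1, h2])
  have heq : ∀ x ∈ Icc 0 ℓ, f x = (∫ s in (0 : ℝ)..x, g s) + c := fun x hx => by
    have := hc x hx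
    rw [Pi.sub_apply] at this
    linarith
  refine ⟨?_, ?_⟩
  · have hac : AbsolutelyContinuousOnInterval (fun x => (∫ s in (0 : ℝ)..x, g s) + c) 0 ℓ :=
      hP.ac.add (contDiffOn_const.absolutelyContinuousOnInterval (f := fun _ => c))
    -- The formula for `f` holds on `[0, ℓ]` only, which suffices because absolute continuity only
    -- involves endpoints in that interval.
    rw [absolutelyContinuousOnInterval_iff] at hac ⊢
    intro r hr
    obtain ⟨δ, hδ, H⟩ := hac r hr
    refine ⟨δ, hδ, fun E hE hlt => ?_⟩
    refine lt_of_eq_of_lt (Finset.sum_congr rfl fun i hi => ?_) (H E hE hlt)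
    have hm := hE.1 i hi
    rw [uIcc_of_le hℓ.le] at hm
    rw [heq _ hm.1, heq _ hm.2]
  · filter_upwards [hP.hasDerivAt] with x hx hm
    refine ((hx hm).add_const c).congr_of_eventuallyEq ?_
    filter_upwards [isOpen_Ioo.mem_nhds hm] with y hy using heq y (Ioo_subset_Icc_self hy)

theorem IsPrimitive.ae_eq_of_eqOn {ℓ : ℝ} {f g F G : ℝ → ℝ} (h : IsPrimitive ℓ f g)
    (H : IsPrimitive ℓ F G) (hfF : EqOn f F (Ioo 0 ℓ)) : g =ᵐ[volume.restrict (Ioo 0 ℓ)] G := by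
  rw [Filter.EventuallyEq, ae_restrict_iff' measurableSet_Ioo]
  filter_upwards [h.hasDerivAt, H.hasDerivAt] with x hx Hx hm
  refine (hx hm).unique ((Hx hm).congr_of_eventuallyEq ?_)
  filter_upwards [isOpen_Ioo.mem_nhds hm] with y hy using hfF hy

namespace W21

variable {ℓ : ℝ}

theorem isPrimitive_toFun (f : W21 ℓ) (hℓ : 0 < ℓ) : IsPrimitive ℓ f.toFun f.der :=
  f.hasWeakDeriv_toFun.isPrimitive hℓ f.continuousOn_toFun f.integrableOn_der

theorem isPrimitive_der (f : W21 ℓ) (hℓ : 0 < ℓ) : IsPrimitive ℓ f.der f.der2 :=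
  f.hasWeakDeriv_der.isPrimitive hℓ f.continuousOn_der f.integrableOn_der2

end W21

/-! ### Smoothed signs and Kato's inequality. -/

/-- A smooth approximation of the sign function. -/
noncomputable def smoothSign (δ r : ℝ) : ℝ := r / √(r ^ 2 + δ ^ 2)

section smoothSign

variable {δ : ℝ}

theorem sqrt_sq_add_sq_pos (hδ : 0 < δ) (r : ℝ) : 0 < √(r ^ 2 + δ ^ 2) :=
  Real.sqrt_pos.2 (add_pos_of_nonneg_of_pos (sq_nonneg r) (pow_pos hδ 2))

theorem le_sqrt_sq_add_sq (δ r : ℝ) : δ ≤ √(r ^ 2 + δ ^ 2) :=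
  Real.le_sqrt_of_sq_le (by nlinarith [sq_nonneg r])

theorem abs_le_sqrt_sq_add_sq (δ r : ℝ) : |r| ≤ √(r ^ 2 + δ ^ 2) :=
  Real.abs_le_sqrt (by nlinarith [sq_nonneg δ])

theorem hasDerivAt_sqrt_sq_add_sq (hδ : 0 < δ) (r : ℝ) :
    HasDerivAt (fun r => √(r ^ 2 + δ ^ 2)) (r / √(r ^ 2 + δ ^ 2)) r := by
  have h : HasDerivAt (fun r : ℝ => r ^ 2 + δ ^ 2) (2 * r) r := by
    simpa using (hasDerivAt_pow 2 r).add_const (δ ^ 2)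
  convert h.sqrt (by positivity) using 1
  field_simp

theorem abs_smoothSign_le (hδ : 0 < δ) (r : ℝ) : |smoothSign δ r| ≤ 1 := by
  rw [smoothSign, abs_div, abs_of_pos (sqrt_sq_add_sq_pos hδ r),
    div_le_one (sqrt_sq_add_sq_pos hδ r)]
  exact abs_le_sqrt_sq_add_sq δ r

theorem hasDerivAt_smoothSign (hδ : 0 < δ) (r : ℝ) :
    HasDerivAt (smoothSign δ) (δ ^ 2 / √(r ^ 2 + δ ^ 2) ^ 3) r := by
  have hp := sqrt_sq_add_sq_pos hδ r
  refine ((hasDerivAt_id r).div (hasDerivAt_sqrt_sq_add_sq hδ r) hp.ne').congr_deriv ?_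
  have hs : √(r ^ 2 + δ ^ 2) ^ 2 = r ^ 2 + δ ^ 2 := Real.sq_sqrt (by positivity)
  simp only [id]
  field_simp
  rw [hs]; ring

/-- An antiderivative of `r` times the derivative of `smoothSign δ`. Its values lie between `-δ` and
`0`, which makes the convection term in Kato's inequality negligible as `δ → 0`. -/
theorem hasDerivAt_neg_div_sqrt (hδ : 0 < δ) (r : ℝ) :
    HasDerivAt (fun r => -δ ^ 2 / √(r ^ 2 + δ ^ 2)) (δ ^ 2 / √(r ^ 2 + δ ^ 2) ^ 3 * r) r := by
  have hp := sqrt_sq_add_sq_pos hδ r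
  refine ((hasDerivAt_const r (-δ ^ 2)).div (hasDerivAt_sqrt_sq_add_sq hδ r) hp.ne').congr_deriv ?_
  field_simp
  ring

theorem lipschitzWith_smoothSign (hδ : 0 < δ) :
    LipschitzWith (Real.toNNReal δ⁻¹) (smoothSign δ) := by
  refine lipschitzWith_of_nnnorm_deriv_le
    (fun r => (hasDerivAt_smoothSign hδ r).differentiableAt) fun r => ?_
  have hp := sqrt_sq_add_sq_pos hδ r
  have h := le_sqrt_sq_add_sq δ r
  rw [← NNReal.coe_le_coe, coe_nnnorm, (hasDerivAt_smoothSign hδ r).deriv,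
    Real.coe_toNNReal _ (by positivity), Real.norm_of_nonneg (by positivity),
    div_le_iff₀ (by positivity)]
  calc δ ^ 2 = δ⁻¹ * δ ^ 3 := by field_simp
    _ ≤ δ⁻¹ * √(r ^ 2 + δ ^ 2) ^ 3 := by gcongr

theorem lipschitzWith_neg_div_sqrt (hδ : 0 < δ) :
    LipschitzWith 1 (fun r => -δ ^ 2 / √(r ^ 2 + δ ^ 2)) := by
  refine lipschitzWith_of_nnnorm_deriv_le
    (fun r => (hasDerivAt_neg_div_sqrt hδ r).differentiableAt) fun r => ?_
  have hp := sqrt_sq_add_sq_pos hδ r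
  have h := le_sqrt_sq_add_sq δ r
  have h' := abs_le_sqrt_sq_add_sq δ r
  rw [← NNReal.coe_le_coe, coe_nnnorm, (hasDerivAt_neg_div_sqrt hδ r).deriv, NNReal.coe_one,
    Real.norm_eq_abs, abs_mul, abs_of_nonneg (by positivity : 0 ≤ δ ^ 2 / √(r ^ 2 + δ ^ 2) ^ 3),
    div_mul_eq_mul_div, div_le_one (by positivity)]
  calc δ ^ 2 * |r| ≤ √(r ^ 2 + δ ^ 2) ^ 2 * √(r ^ 2 + δ ^ 2) := by gcongr
    _ = _ := by ring

theorem tendsto_smoothSign (r : ℝ) :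
    Tendsto (fun δ => smoothSign δ r) (𝓝[>] 0) (𝓝 (SignType.sign r : ℝ)) := by
  rcases eq_or_ne r 0 with rfl | hr
  · simp [smoothSign]
  · have hc : ContinuousAt (fun δ => smoothSign δ r) 0 := by
      unfold smoothSign
      have : √(r ^ 2 + 0 ^ 2) ≠ 0 := by positivity
      fun_prop (disch := assumption)
    have h0 : smoothSign 0 r = SignType.sign r := by
      simp only [smoothSign, ne_eq, OfNat.ofNat_ne_zero, not_false_eq_true, zero_pow, add_zero,
        Real.sqrt_sq_eq_abs]
      rw [div_eq_iff (by simpa using hr), sign_mul_abs]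
    rw [← h0]
    exact hc.tendsto.mono_left nhdsWithin_le_nhds

end smoothSign

theorem measurable_coe_sign : Measurable (fun r : ℝ => (SignType.sign r : ℝ)) := by
  have : (fun r : ℝ => (SignType.sign r : ℝ)) =
      fun r => if 0 < r then 1 else if r < 0 then -1 else 0 := by
    ext r
    rcases lt_trichotomy r 0 with h | h | h
    · simp [h, h.not_gt]
    · simp [h]
    · simp [h]
  rw [this]
  exact Measurable.ite measurableSet_Ioi measurable_const
    (Measurable.ite measurableSet_Iio measurable_const measurable_const)

theorem abs_coe_sign_le (r : ℝ) : |(SignType.sign r : ℝ)| ≤ 1 := by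
  rcases lt_trichotomy r 0 with h | h | h <;> simp [h]

theorem coe_sign_mul_sub_le (a b : ℝ) : (SignType.sign a : ℝ) * (b - a) ≤ |b| - |a| := by
  have h1 := sign_mul_self a
  have h2 : (SignType.sign a : ℝ) * b ≤ |b| := by
    calc _ ≤ |(SignType.sign a : ℝ) * b| := le_abs_self _
      _ = |(SignType.sign a : ℝ)| * |b| := abs_mul _ _
      _ ≤ 1 * |b| := by gcongr; exact abs_coe_sign_le a
      _ = |b| := one_mul _
  rw [mul_sub, h1]
  linarith

/-- Integrate by parts against the flux `λw - εw₁`. The diffusion part has a favourable sign, and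
the convection part is an exact derivative whose integral is at most `λδ`. -/
theorem integral_smoothSign_mul_le {ℓ lam ε δ : ℝ} (hℓ : 0 < ℓ) (hlam : 0 < lam) (hε : 0 < ε)
    (hδ : 0 < δ) {w w₁ w₂ : ℝ → ℝ} (h : IsPrimitive ℓ w w₁) (h₁ : IsPrimitive ℓ w₁ w₂) :
    ∫ x in Ioo 0 ℓ, smoothSign δ (w x) * (-(lam * w₁ x) + ε * w₂ x) ≤
      smoothSign δ (w 0) * (lam * w 0 - ε * w₁ 0) -
        smoothSign δ (w ℓ) * (lam * w ℓ - ε * w₁ ℓ) + lam * δ := by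
  have hs := h.comp (lipschitzWith_smoothSign hδ) (hasDerivAt_smoothSign hδ)
  have hF := (h.const_mul lam).sub (h₁.const_mul ε)
  have hP := hs.mul hF
  have hΦ := (h.comp (lipschitzWith_neg_div_sqrt hδ) (hasDerivAt_neg_div_sqrt hδ)).const_mul lam
  have e1 := hP.integral_eq hℓ
  have e2 := hΦ.integral_eq hℓ
  have hbound : ∀ r : ℝ, -δ ≤ -δ ^ 2 / √(r ^ 2 + δ ^ 2) ∧ -δ ^ 2 / √(r ^ 2 + δ ^ 2) ≤ 0 := by
    intro r
    have hp := sqrt_sq_add_sq_pos hδ r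
    have h := le_sqrt_sq_add_sq δ r
    rw [neg_div]
    refine ⟨neg_le_neg ?_, neg_nonpos.2 (by positivity)⟩
    rw [div_le_iff₀ hp]
    nlinarith
  have iS : IntegrableOn (fun x => smoothSign δ (w x) * (-(lam * w₁ x) + ε * w₂ x))
      (Ioo 0 ℓ) := by
    have := (hF.intervalIntegrable hℓ).neg.continuousOn_mul (hs.ac.continuousOn)
    rw [intervalIntegrable_iff_integrableOn_Ioo_of_le hℓ.le] at this
    refine this.congr (ae_of_all _ fun x => ?_)
    simp only [Pi.neg_apply]; ring
  have key : ∫ x in Ioo 0 ℓ, smoothSign δ (w x) * (-(lam * w₁ x) + ε * w₂ x) ≤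
      ∫ x in Ioo 0 ℓ, (lam * (δ ^ 2 / √(w x ^ 2 + δ ^ 2) ^ 3 * w x * w₁ x) -
        (δ ^ 2 / √(w x ^ 2 + δ ^ 2) ^ 3 * w₁ x * (lam * w x - ε * w₁ x) +
          smoothSign δ (w x) * (lam * w₁ x - ε * w₂ x))) := by
    refine setIntegral_mono_on iS ((hΦ.integrableOn hℓ).sub (hP.integrableOn hℓ))
      measurableSet_Ioo fun x _ => ?_
    -- This is the diffusion term, the only one discarded.
    have : 0 ≤ ε * (δ ^ 2 / √(w x ^ 2 + δ ^ 2) ^ 3) * w₁ x ^ 2 := by positivity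
    nlinarith
  rw [integral_sub (hΦ.integrableOn hℓ) (hP.integrableOn hℓ), e1, e2] at key
  have b1 := mul_le_mul_of_nonneg_left (hbound (w ℓ)).2 hlam.le
  have b0 := mul_le_mul_of_nonneg_left (hbound (w 0)).1 hlam.le
  linarith

/-- Kato's inequality on an arc. -/
theorem integral_sign_mul_le {ℓ lam ε : ℝ} (hℓ : 0 < ℓ) (hlam : 0 < lam) (hε : 0 < ε)
    {w w₁ w₂ : ℝ → ℝ} (h : IsPrimitive ℓ w w₁) (h₁ : IsPrimitive ℓ w₁ w₂) :
    ∫ x in Ioo 0 ℓ, (SignType.sign (w x) : ℝ) * (-(lam * w₁ x) + ε * w₂ x) ≤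
      SignType.sign (w 0) * (lam * w 0 - ε * w₁ 0) -
        SignType.sign (w ℓ) * (lam * w ℓ - ε * w₁ ℓ) := by
  have hG : IntegrableOn (fun x => -(lam * w₁ x) + ε * w₂ x) (Ioo 0 ℓ) :=
    ((h.integrableOn hℓ).const_mul lam).neg.add ((h₁.integrableOn hℓ).const_mul ε)
  have hlim : Tendsto
      (fun δ => ∫ x in Ioo 0 ℓ, smoothSign δ (w x) * (-(lam * w₁ x) + ε * w₂ x)) (𝓝[>] 0)
      (𝓝 (∫ x in Ioo 0 ℓ, (SignType.sign (w x) : ℝ) * (-(lam * w₁ x) + ε * w₂ x))) := by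
    refine tendsto_integral_filter_of_dominated_convergence
      (fun x => |-(lam * w₁ x) + ε * w₂ x|) ?_ ?_ hG.abs ?_
    · filter_upwards [self_mem_nhdsWithin] with δ hδ
      refine AEStronglyMeasurable.mul ?_ hG.aestronglyMeasurable
      exact ((lipschitzWith_smoothSign hδ).continuous.comp_continuousOn
        ((h.continuousOn hℓ).mono Ioo_subset_Icc_self)).aestronglyMeasurable measurableSet_Ioo
    · filter_upwards [self_mem_nhdsWithin] with δ hδ
      refine ae_of_all _ fun x => ?_
      rw [Real.norm_eq_abs, abs_mul]
      exact mul_le_of_le_one_left (abs_nonneg _) (abs_smoothSign_le hδ _)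
    · exact ae_of_all _ fun x => (tendsto_smoothSign _).mul_const _
  have hδ0 : Tendsto (fun δ : ℝ => lam * δ) (𝓝[>] 0) (𝓝 0) := by
    have : Tendsto (fun δ : ℝ => lam * δ) (𝓝 0) (𝓝 (lam * 0)) := tendsto_id.const_mul lam
    rw [mul_zero] at this
    exact this.mono_left nhdsWithin_le_nhds
  have hR := (((tendsto_smoothSign (w 0)).mul_const (lam * w 0 - ε * w₁ 0)).sub
    ((tendsto_smoothSign (w ℓ)).mul_const (lam * w ℓ - ε * w₁ ℓ))).add hδ0
  rw [add_zero] at hR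
  refine le_of_tendsto_of_tendsto hlim hR ?_
  filter_upwards [self_mem_nhdsWithin] with δ hδ
  exact integral_smoothSign_mul_le hℓ hlam hε hδ h h₁

/-- The `L¹` norm of a solution of `ε z' - λ z = g`. -/
theorem integral_abs_le_of_ode {ℓ lam ε : ℝ} (hℓ : 0 < ℓ) (hlam : 0 < lam) (hε : 0 < ε)
    {z z₁ : ℝ → ℝ} (h : IsPrimitive ℓ z z₁) :
    lam * ∫ x in Ioo 0 ℓ, |z x| ≤ ε * |z ℓ| + ∫ x in Ioo 0 ℓ, |-(lam * z x) + ε * z₁ x| := by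
  have e := (h.abs.const_mul ε).integral_eq hℓ
  have hz : IntegrableOn z (Ioo 0 ℓ) :=
    (h.continuousOn hℓ).integrableOn_Icc.mono_set Ioo_subset_Icc_self
  have hG : IntegrableOn (fun x => -(lam * z x) + ε * z₁ x) (Ioo 0 ℓ) :=
    (hz.const_mul lam).neg.add ((h.integrableOn hℓ).const_mul ε)
  have i1 := (h.abs.const_mul ε).integrableOn hℓ
  have key : ∫ x in Ioo 0 ℓ, lam * |z x| ≤ ∫ x in Ioo 0 ℓ,
      (ε * (SignType.sign (z x) * z₁ x) + |-(lam * z x) + ε * z₁ x|) := by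
    refine setIntegral_mono_on (hz.abs.const_mul lam) (i1.add hG.abs) measurableSet_Ioo
      fun x _ => ?_
    have h1 := neg_le_of_abs_le ((abs_mul (SignType.sign (z x) : ℝ)
      (-(lam * z x) + ε * z₁ x)).le.trans
      (mul_le_of_le_one_left (abs_nonneg _) (abs_coe_sign_le _)))
    have h2 := sign_mul_self (z x)
    nlinarith
  rw [integral_const_mul, integral_add i1 hG.abs, e] at key
  have : 0 ≤ ε * |z 0| := by positivity
  linarith

/-! ### Dissipative evolution in `L¹`. -/

/-- The functional `g ↦ ∫ sign(f) g` on `L¹`, which norms `f`. -/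
theorem exists_clm_integral_sign_mul {α : Type*} [MeasurableSpace α] {μ : Measure α}
    (f : Lp ℝ 1 μ) : ∃ S : Lp ℝ 1 μ →L[ℝ] ℝ,
      (∀ g, S g = ∫ x, (SignType.sign (f x) : ℝ) * g x ∂μ) ∧ (∀ g, S g ≤ ‖g‖) ∧ S f = ‖f‖ := by
  have hint : ∀ g : Lp ℝ 1 μ, Integrable (fun x => (SignType.sign (f x) : ℝ) * g x) μ :=
    fun g => (L1.integrable_coeFn g).bdd_mul (c := 1)
      ((measurable_coe_sign.comp_aemeasurable
        (Lp.aestronglyMeasurable f).aemeasurable).aestronglyMeasurable)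
      (ae_of_all _ fun x => abs_coe_sign_le _)
  have hle : ∀ g : Lp ℝ 1 μ, |∫ x, (SignType.sign (f x) : ℝ) * g x ∂μ| ≤ ‖g‖ := fun g => by
    rw [L1.norm_eq_integral_norm]
    refine abs_integral_le_integral_abs.trans
      (integral_mono (hint g).abs (L1.integrable_coeFn g).norm fun x => ?_)
    simp only [abs_mul, Real.norm_eq_abs]
    exact mul_le_of_le_one_left (abs_nonneg _) (abs_coe_sign_le _)
  let S : Lp ℝ 1 μ →ₗ[ℝ] ℝ :=
    { toFun := fun g => ∫ x, (SignType.sign (f x) : ℝ) * g x ∂μ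
      map_add' := fun g g' => by
        rw [← integral_add (hint g) (hint g')]
        refine integral_congr_ae ?_
        filter_upwards [Lp.coeFn_add g g'] with x hx
        rw [hx, Pi.add_apply, mul_add]
      map_smul' := fun c g => by
        rw [RingHom.id_apply, smul_eq_mul, ← integral_const_mul]
        refine integral_congr_ae ?_
        filter_upwards [Lp.coeFn_smul c g] with x hx
        rw [hx, Pi.smul_apply, smul_eq_mul]
        ring }
  refine ⟨S.mkContinuous 1 fun g => by rw [one_mul]; exact hle g, fun g => rfl,
    fun g => (le_abs_self _).trans (hle g), ?_⟩
  change ∫ x, (SignType.sign (f x) : ℝ) * f x ∂μ = ‖f‖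
  rw [L1.norm_eq_integral_norm]
  exact integral_congr_ae (ae_of_all _ fun x => sign_mul_self _)

/-- The sum of the norms decreases along a curve whose velocity is dissipative. -/
theorem sum_norm_le_of_dissipative {ι : Type*} [Fintype ι] {E : ι → Type*}
    [∀ i, NormedAddCommGroup (E i)] [∀ i, NormedSpace ℝ (E i)] {a b : ℝ} (hab : a ≤ b)
    {w w' : ∀ i, ℝ → E i}
    (hw : ∀ i, ∀ t ∈ Icc a b, HasDerivWithinAt (w i) (w' i t) (Icc a b) t)
    (hd : ∀ t ∈ Icc a b, ∃ S : ∀ i, E i →L[ℝ] ℝ, (∀ i x, S i x ≤ ‖x‖) ∧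
      (∀ i, S i (w i t) = ‖w i t‖) ∧ ∑ i, S i (w' i t) ≤ 0) :
    ∑ i, ‖w i b‖ ≤ ∑ i, ‖w i a‖ := by
  -- A norming functional at `t` gives `‖w t‖ - ‖w s‖ ≤ S (w t - w s)`, which bounds difference
  -- quotients of the norm for `s < t` only. Reversing time turns them into the right slopes of the
  -- comparison lemma, so the norm need not be differentiable.
  set f : ℝ → ℝ := fun τ => -∑ i, ‖w i (a + b - τ)‖ with hf
  have hmaps : MapsTo (fun τ => a + b - τ) (Icc a b) (Icc a b) := fun τ hτ =>
    ⟨by linarith [hτ.2], by linarith [hτ.1]⟩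
  have hcont : ContinuousOn f (Icc a b) := by
    refine (continuousOn_finsetSum _ fun i _ => ?_).neg
    have : ContinuousOn (w i) (Icc a b) := fun t ht => (hw i t ht).continuousWithinAt
    exact (this.comp (by fun_prop) hmaps).norm
  have key := image_le_of_liminf_slope_right_le_deriv_boundary (B := fun _ => f a)
    (B' := fun _ => 0) hcont le_rfl continuousOn_const
    (fun x _ => hasDerivWithinAt_const _ _ _) ?_ (right_mem_Icc.2 hab)
  · simp only [hf, add_sub_cancel_right, add_sub_cancel_left, neg_le_neg_iff] at key
    exact key
  intro x hx r hr
  set t := a + b - x with ht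
  have htm : t ∈ Icc a b := hmaps (Ico_subset_Icc_self hx)
  obtain ⟨S, hS1, hS2, hS3⟩ := hd t htm
  have hG : HasDerivWithinAt (fun s => ∑ i, S i (w i s)) (∑ i, S i (w' i t)) (Icc a b) t :=
    HasDerivWithinAt.fun_sum fun i _ => (S i).hasFDerivAt.comp_hasDerivWithinAt t (hw i t htm)
  rw [hasDerivWithinAt_iff_tendsto_slope] at hG
  have hmap : Tendsto (fun z => a + b - z) (𝓝[>] x) (𝓝[Icc a b \ {t}] t) := by
    refine tendsto_nhdsWithin_iff.2 ⟨?_, ?_⟩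
    · exact ((continuous_const.sub continuous_id).tendsto x).mono_left nhdsWithin_le_nhds
    · filter_upwards [Ioo_mem_nhdsGT hx.2] with z hz
      refine ⟨hmaps ⟨hx.1.trans hz.1.le, hz.2.le⟩, fun h => ?_⟩
      have : a + b - z = t := h
      linarith [hz.1]
  have hev := (hG.comp hmap).eventually (gt_mem_nhds (lt_of_le_of_lt hS3 hr))
  refine (hev.and self_mem_nhdsWithin).frequently.mono fun z hz => ?_
  refine lt_of_le_of_lt ?_ hz.1
  have hzx : 0 < z - x := sub_pos.2 hz.2
  simp only [Function.comp, slope_def_field, hf]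
  rw [← ht, ← neg_div_neg_eq, show -(z - x) = a + b - z - t by rw [ht]; ring]
  have hneg : a + b - z - t < 0 := by rw [ht]; linarith
  refine div_le_div_of_nonpos_of_le hneg.le ?_
  have h1 : ∑ i, S i (w i (a + b - z)) ≤ ∑ i, ‖w i (a + b - z)‖ :=
    Finset.sum_le_sum fun i _ => hS1 i _
  have h2 : ∑ i, S i (w i t) = ∑ i, ‖w i t‖ := Finset.sum_congr rfl fun i _ => hS2 i
  rw [h2]
  linarith

namespace StarNetwork

variable {ι : Type*} [Fintype ι] [DecidableEq ι] {N : StarNetwork ι}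

/-- Dissipativity of the transport-diffusion operator with transmission conditions. -/
theorem sum_integral_sign_mul_nonpos {lam : ι → ℝ} (hlam : ∀ i, 0 < lam i) {K : ι → ι → ℝ}
    (hK : ∀ i j, 0 ≤ K i j) (hKs : ∀ i j, K i j = K j i) {ε : ℝ} (hε : 0 < ε)
    {f g : ∀ i, W21 (N.length i)} (hf : N.Transmission lam K ε f)
    (hg : N.Transmission lam K ε g) (hin : ∀ i ∈ N.incoming, (f i).toFun 0 = (g i).toFun 0)
    (hout : ∀ i ∉ N.incoming, (f i).toFun (N.length i) = (g i).toFun (N.length i)) :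
    ∑ i, ∫ x in Ioo 0 (N.length i), (SignType.sign ((f i).toFun x - (g i).toFun x) : ℝ) *
      (-(lam i * ((f i).der x - (g i).der x)) + ε * ((f i).der2 x - (g i).der2 x)) ≤ 0 := by
  set d : ι → ℝ := fun i => (f i).toFun (N.inner i) - (g i).toFun (N.inner i) with hd
  have hflux : ∀ i, N.beta i * (-lam i * d i +
      ε * ((f i).der (N.inner i) - (g i).der (N.inner i))) = ∑ j, K i j * (d j - d i) := by
    intro i
    have h : ∑ j, K i j * (d j - d i) =
        ∑ j, K i j * ((f j).toFun (N.inner j) - (f i).toFun (N.inner i)) -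
        ∑ j, K i j * ((g j).toFun (N.inner j) - (g i).toFun (N.inner i)) := by
      rw [← Finset.sum_sub_distrib]
      exact Finset.sum_congr rfl fun j _ => by rw [hd]; ring
    rw [h, ← hf i, ← hg i, hd]
    ring
  have harc : ∀ i, ∫ x in Ioo 0 (N.length i),
      (SignType.sign ((f i).toFun x - (g i).toFun x) : ℝ) *
      (-(lam i * ((f i).der x - (g i).der x)) + ε * ((f i).der2 x - (g i).der2 x)) ≤
      ∑ j, K i j * (|d j| - |d i|) := by
    intro i
    have hℓ := N.length_pos i
    have hmain := integral_sign_mul_le hℓ (hlam i) hε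
      (((f i).isPrimitive_toFun hℓ).sub ((g i).isPrimitive_toFun hℓ))
      (((f i).isPrimitive_der hℓ).sub ((g i).isPrimitive_der hℓ))
    have hsum : (SignType.sign (d i) : ℝ) * ∑ j, K i j * (d j - d i) ≤
        ∑ j, K i j * (|d j| - |d i|) := by
      rw [Finset.mul_sum]
      refine Finset.sum_le_sum fun j _ => ?_
      have := mul_le_mul_of_nonneg_left (coe_sign_mul_sub_le (d i) (d j)) (hK i j)
      linarith
    refine hmain.trans (le_trans (le_of_eq ?_) hsum)
    rw [← hflux i]
    -- At the outer end the difference vanishes and so does its sign, so only the boundary term at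
    -- the inner node survives.
    by_cases hi : i ∈ N.incoming
    · simp only [hd, inner, beta, hi, if_true, hin i hi, sub_self, sign_zero, SignType.coe_zero]
      ring
    · simp only [hd, inner, beta, hi, if_false, hout i hi, sub_self, sign_zero, SignType.coe_zero]
      ring
  refine (Finset.sum_le_sum fun i _ => harc i).trans (le_of_eq ?_)
  -- Exchanging the indices and using the symmetry of `K` shows that the double sum equals its own
  -- negative.
  have hanti : ∑ i, ∑ j, K i j * (|d j| - |d i|) = -∑ i, ∑ j, K i j * (|d j| - |d i|) := by
    conv_lhs => rw [Finset.sum_comm]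
    rw [← Finset.sum_neg_distrib]
    refine Finset.sum_congr rfl fun i _ => ?_
    rw [← Finset.sum_neg_distrib]
    exact Finset.sum_congr rfl fun j _ => by rw [hKs j i]; ring
  linarith

namespace IsSolution

variable {lam : ι → ℝ} {K : ι → ι → ℝ} {B : ι → ℝ} {ε : ℝ} {v : ∀ i, W21 (N.length i)} {T : ℝ}
  {u : ∀ i, ℝ → W21 (N.length i)}

/-- The velocity of the solution in `L¹`. -/
noncomputable def velocity (_ : N.IsSolution lam K B ε v T u) (i : ι) (t : ℝ) :
    L1Arc (N.length i) :=
  -(lam i • (u i t).derL1) + ε • (u i t).der2L1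

theorem hasDerivWithinAt (hu : N.IsSolution lam K B ε v T u) (i : ι) {t : ℝ} (ht : t ∈ Icc 0 T) :
    HasDerivWithinAt (fun s => (u i s).toL1) (hu.velocity i t) (Icc 0 T) t := by
  have h := ((hu.contDiff_L1 i).differentiableOn (by simp) t ht).hasDerivWithinAt
  rwa [hu.equation i t ht] at h

theorem velocity_coeFn (hu : N.IsSolution lam K B ε v T u) (i : ι) (t : ℝ) :
    hu.velocity i t =ᵐ[volume.restrict (Ioo 0 (N.length i))]
      fun x => -(lam i * (u i t).der x) + ε * (u i t).der2 x := by
  unfold velocity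
  filter_upwards [Lp.coeFn_add (-(lam i • (u i t).derL1)) (ε • (u i t).der2L1),
    Lp.coeFn_neg (lam i • (u i t).derL1), Lp.coeFn_smul (lam i) (u i t).derL1,
    Lp.coeFn_smul ε (u i t).der2L1, Integrable.coeFn_toL1 (u i t).integrableOn_der,
    Integrable.coeFn_toL1 (u i t).integrableOn_der2] with x h1 h2 h3 h4 h5 h6
  rw [h1, Pi.add_apply, h2, Pi.neg_apply, h3, h4, Pi.smul_apply, Pi.smul_apply, W21.derL1, W21.der2L1,
    h5, h6, smul_eq_mul, smul_eq_mul]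

/-- The boundary data do not depend on time, so dissipativity applies to the difference of the
solution and its translate by `h`. -/
theorem sum_norm_sub_le (hlam : ∀ i, 0 < lam i) (hK : ∀ i j, 0 ≤ K i j)
    (hKs : ∀ i j, K i j = K j i) (hε : 0 < ε) (hu : N.IsSolution lam K B ε v T u) {h t : ℝ}
    (hh : 0 ≤ h) (ht : 0 ≤ t) (hth : t + h ≤ T) :
    ∑ i, ‖(u i (t + h)).toL1 - (u i t).toL1‖ ≤ ∑ i, ‖(u i h).toL1 - (u i 0).toL1‖ := by
  have hm1 : ∀ s ∈ Icc 0 t, s + h ∈ Icc 0 T := fun s hs =>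
    ⟨add_nonneg hs.1 hh, by linarith [hs.2]⟩
  have hm0 : ∀ s ∈ Icc 0 t, s ∈ Icc 0 T := fun s hs => ⟨hs.1, by linarith [hs.2]⟩
  have := sum_norm_le_of_dissipative (E := fun i => L1Arc (N.length i)) ht
    (w := fun i s => (u i (s + h)).toL1 - (u i s).toL1)
    (w' := fun i s => hu.velocity i (s + h) - hu.velocity i s) ?_ ?_
  · simpa using this
  · intro i s hs
    have h1 := (hu.hasDerivWithinAt i (hm1 s hs)).scomp s
      ((hasDerivWithinAt_id s (Icc 0 t)).add_const h) hm1
    rw [one_smul] at h1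
    exact h1.sub ((hu.hasDerivWithinAt i (hm0 s hs)).mono hm0)
  · intro s hs
    choose S hS1 hS2 hS3 using fun i =>
      exists_clm_integral_sign_mul ((u i (s + h)).toL1 - (u i s).toL1)
    refine ⟨S, hS2, hS3, ?_⟩
    have hdis := sum_integral_sign_mul_nonpos hlam hK hKs hε (hu.transmission _ (hm1 s hs))
      (hu.transmission _ (hm0 s hs))
      (fun i hi => by rw [hu.outer_incoming i hi _ (hm1 s hs), hu.outer_incoming i hi _ (hm0 s hs)])
      (fun i hi => by rw [hu.outer_outgoing i hi _ (hm1 s hs), hu.outer_outgoing i hi _ (hm0 s hs)])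
    refine le_trans (le_of_eq (Finset.sum_congr rfl fun i _ => ?_)) hdis
    rw [hS1]
    refine integral_congr_ae ?_
    filter_upwards [Lp.coeFn_sub (u i (s + h)).toL1 (u i s).toL1,
      Lp.coeFn_sub (hu.velocity i (s + h)) (hu.velocity i s), hu.velocity_coeFn i (s + h),
      hu.velocity_coeFn i s, Integrable.coeFn_toL1 (u i (s + h)).integrableOn_toFun,
      Integrable.coeFn_toL1 (u i s).integrableOn_toFun] with x h1 h2 h3 h4 h5 h6
    rw [h1, h2, Pi.sub_apply, Pi.sub_apply, h3, h4, W21.toL1, W21.toL1, h5, h6]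
    ring

/-- Divide the contraction estimate for translates by `h` and let `h → 0⁺`; forward translates
require `t < T`. -/
theorem sum_norm_velocity_le (hlam : ∀ i, 0 < lam i) (hK : ∀ i j, 0 ≤ K i j)
    (hKs : ∀ i j, K i j = K j i) (hε : 0 < ε) (hu : N.IsSolution lam K B ε v T u) {t : ℝ}
    (ht : t ∈ Ico 0 T) : ∑ i, ‖hu.velocity i t‖ ≤ ∑ i, ‖hu.velocity i 0‖ := by
  have hlim : ∀ s ∈ Ico 0 T, Tendsto
      (fun h : ℝ => ∑ i, ‖h⁻¹ • ((u i (s + h)).toL1 - (u i s).toL1)‖) (𝓝[>] 0)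
      (𝓝 (∑ i, ‖hu.velocity i s‖)) := by
    intro s hs
    refine tendsto_finsetSum _ fun i _ => Tendsto.norm ?_
    have h1 : HasDerivWithinAt (fun s => (u i s).toL1) (hu.velocity i s) (Ioi s) s :=
      (hu.hasDerivWithinAt i (Ico_subset_Icc_self hs)).mono_of_mem_nhdsWithin
        (mem_of_superset (Ioo_mem_nhdsGT hs.2) fun z hz => ⟨hs.1.trans hz.1.le, hz.2.le⟩)
    rw [hasDerivWithinAt_iff_tendsto_slope' (by simp)] at h1
    have hmap : Tendsto (fun h : ℝ => s + h) (𝓝[>] 0) (𝓝[>] s) := by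
      refine tendsto_nhdsWithin_iff.2 ⟨?_, ?_⟩
      · have : Tendsto (fun h : ℝ => s + h) (𝓝 0) (𝓝 (s + 0)) :=
          (continuous_const.add continuous_id).tendsto 0
        rw [add_zero] at this
        exact this.mono_left nhdsWithin_le_nhds
      · filter_upwards [self_mem_nhdsWithin] with h hh using lt_add_of_pos_right s hh
    refine (h1.comp hmap).congr fun h => ?_
    simp [slope]
  have h0 : (0 : ℝ) ∈ Ico 0 T := ⟨le_rfl, ht.1.trans_lt ht.2⟩
  refine le_of_tendsto_of_tendsto (hlim t ht) (hlim 0 h0) ?_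
  filter_upwards [Ioo_mem_nhdsGT (sub_pos.2 ht.2)] with h hh
  simp only [norm_smul, ← Finset.mul_sum, zero_add]
  exact mul_le_mul_of_nonneg_left
    (hu.sum_norm_sub_le hlam hK hKs hε hh.1.le ht.1 (by linarith [hh.2])) (norm_nonneg _)

/-- The velocity at time `0` is bounded by the norms of the initial datum. -/
theorem sum_norm_velocity_zero_le (hlam : ∀ i, 0 < lam i) (hε : 0 < ε)
    (hu : N.IsSolution lam K B ε v T u) :
    ∑ i, ‖hu.velocity i 0‖ ≤ (∑ i, lam i) * ∑ i, ‖(v i).derL1‖ + ε * ∑ i, (v i).norm := by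
  rw [Finset.mul_sum, Finset.mul_sum, ← Finset.sum_add_distrib]
  refine Finset.sum_le_sum fun i _ => ?_
  have hℓ := N.length_pos i
  have e1 : (u i 0).der =ᵐ[volume.restrict (Ioo 0 (N.length i))] (v i).der :=
    ((u i 0).isPrimitive_toFun hℓ).ae_eq_of_eqOn ((v i).isPrimitive_toFun hℓ) (hu.initial i)
  -- Continuity upgrades almost everywhere equality to equality on the open arc, so that the
  -- argument can be repeated for the second derivatives.
  have e1' : EqOn (u i 0).der (v i).der (Ioo 0 (N.length i)) :=
    Measure.eqOn_Ioo_of_ae_eq volume e1 ((u i 0).continuousOn_der.mono Ioo_subset_Icc_self)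
      ((v i).continuousOn_der.mono Ioo_subset_Icc_self)
  have e2 : (u i 0).der2 =ᵐ[volume.restrict (Ioo 0 (N.length i))] (v i).der2 :=
    ((u i 0).isPrimitive_der hℓ).ae_eq_of_eqOn ((v i).isPrimitive_der hℓ) e1'
  have d1 : (u i 0).derL1 = (v i).derL1 := (Integrable.toL1_eq_toL1_iff _ _ _ _).2 e1
  have d2 : (u i 0).der2L1 = (v i).der2L1 := (Integrable.toL1_eq_toL1_iff _ _ _ _).2 e2
  rw [velocity, d1, d2]
  refine (norm_add_le _ _).trans ?_
  rw [norm_neg, norm_smul, norm_smul, Real.norm_of_nonneg (hlam i).le, Real.norm_of_nonneg hε.le]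
  refine add_le_add (mul_le_mul_of_nonneg_right ?_ (norm_nonneg _))
    (mul_le_mul_of_nonneg_left ?_ hε.le)
  · exact Finset.single_le_sum (fun j _ => (hlam j).le) (Finset.mem_univ i)
  · rw [W21.norm]
    linarith [norm_nonneg (v i).toL1, norm_nonneg (v i).derL1]

end IsSolution

end StarNetwork

/-! ### Bounds at a fixed time, uniform in the viscosity. -/

theorem exp_neg_div_mul_lt_one {lam ε ℓ : ℝ} (hlam : 0 < lam) (hε : 0 < ε) (hℓ : 0 < ℓ) :
    Real.exp (-(lam / ε) * ℓ) < 1 := by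
  rw [Real.exp_lt_one_iff, neg_mul]
  exact neg_neg_of_pos (by positivity)

/-- Comparison of the end values of `f` when the flux `λ f - ε f'` is bounded below. -/
theorem IsPrimitive.exp_mul_le_of_le_flux {ℓ lam ε m : ℝ} (hℓ : 0 < ℓ) (hlam : 0 < lam)
    (hε : 0 < ε) {f f₁ : ℝ → ℝ} (h : IsPrimitive ℓ f f₁)
    (hm : ∀ x ∈ Icc 0 ℓ, m ≤ lam * f x - ε * f₁ x) :
    Real.exp (-(lam / ε) * ℓ) * (f ℓ - m / lam) ≤ f 0 - m / lam := by
  have he : ContDiff ℝ 1 (fun x : ℝ => Real.exp (-(lam / ε) * x)) := by fun_prop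
  have hd : ∀ x, deriv (fun x : ℝ => Real.exp (-(lam / ε) * x)) x =
      Real.exp (-(lam / ε) * x) * (-(lam / ε)) := fun x => by
    have := ((hasDerivAt_id x).const_mul (-(lam / ε))).exp
    simpa using this.deriv
  have hc : IsPrimitive ℓ (fun _ => m / lam) (deriv fun _ => m / lam) :=
    IsPrimitive.of_contDiff contDiff_const
  have H := (IsPrimitive.of_contDiff (ℓ := ℓ) he).mul (h.sub hc)
  have hle : ∫ x in Ioo 0 ℓ, (deriv (fun x : ℝ => Real.exp (-(lam / ε) * x)) x *
      (f x - m / lam) + Real.exp (-(lam / ε) * x) * (f₁ x - deriv (fun _ => m / lam) x)) ≤ 0 := by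
    refine setIntegral_nonpos measurableSet_Ioo fun x hx => ?_
    have h1 := hm x (Ioo_subset_Icc_self hx)
    -- The function `exp(-λx/ε) (f - m/λ)` is nonincreasing: its derivative is `-exp(-λx/ε)/ε` times
    -- the excess of the flux over `m`.
    have h2 : Real.exp (-(lam / ε) * x) * (-(lam / ε)) * (f x - m / lam) +
        Real.exp (-(lam / ε) * x) * (f₁ x - 0) =
        -(Real.exp (-(lam / ε) * x) / ε * (lam * f x - ε * f₁ x - m)) := by
      field_simp
      ring
    rw [hd, deriv_const, h2]
    exact neg_nonpos.2 (mul_nonneg (by positivity) (by linarith))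
  rw [H.integral_eq hℓ] at hle
  simp only [mul_zero, Real.exp_zero, one_mul] at hle
  linarith

/-- A flux that stays large would drive `f` negative at the right end when `f 0` is bounded. Thus `f
ℓ ≥ 0` caps any lower bound of the flux. -/
theorem IsPrimitive.flux_lower_bound {ℓ lam ε ε₀ m : ℝ} (hℓ : 0 < ℓ) (hlam : 0 < lam)
    (hε : 0 < ε) (hεε₀ : ε ≤ ε₀) {f f₁ : ℝ → ℝ} (h : IsPrimitive ℓ f f₁)
    (hm : ∀ x ∈ Icc 0 ℓ, m ≤ lam * f x - ε * f₁ x) (hf : 0 ≤ f ℓ) :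
    m ≤ lam * |f 0| / (1 - Real.exp (-(lam / ε₀) * ℓ)) := by
  have h1 := h.exp_mul_le_of_le_flux hℓ hlam hε hm
  have hε₀ := hε.trans_le hεε₀
  set q := Real.exp (-(lam / ε) * ℓ)
  set q₀ := Real.exp (-(lam / ε₀) * ℓ)
  have hq : 0 < q := Real.exp_pos _
  have hq₀ : q₀ < 1 := exp_neg_div_mul_lt_one hlam hε₀ hℓ
  -- The exponential increases with the viscosity, so `ε₀` gives the smallest denominator and a
  -- constant independent of `ε`.
  have hqq : q ≤ q₀ := by
    refine Real.exp_le_exp.2 (mul_le_mul_of_nonneg_right (neg_le_neg ?_) hℓ.le)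
    exact div_le_div_of_nonneg_left hlam.le hε hεε₀
  rw [le_div_iff₀ (by linarith)]
  rcases le_total m 0 with hm0 | hm0
  · have : 0 ≤ lam * |f 0| := by positivity
    nlinarith
  · have h2 : lam * (m / lam) = m := by field_simp
    have h3 : m * (1 - q) ≤ lam * f 0 := by
      have := mul_le_mul_of_nonneg_left h1 hlam.le
      have h4 : 0 ≤ lam * (q * f ℓ) := by positivity
      have h5 : lam * (q * (f ℓ - m / lam)) = lam * (q * f ℓ) - q * m := by
        rw [← h2]; field_simp
      rw [h5, mul_sub, h2] at this
      linarith
    have h6 : lam * f 0 ≤ lam * |f 0| := mul_le_mul_of_nonneg_left (le_abs_self _) hlam.le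
    nlinarith

/-- The exponential comparison applied to `-f` makes `f 0` at most a convex combination of `f ℓ` and
`M / λ`, so no upper bound on `ε` is needed. -/
theorem IsPrimitive.left_value_upper_bound {ℓ lam ε M : ℝ} (hℓ : 0 < ℓ) (hlam : 0 < lam)
    (hε : 0 < ε) {f f₁ : ℝ → ℝ} (h : IsPrimitive ℓ f f₁)
    (hM : ∀ x ∈ Icc 0 ℓ, lam * f x - ε * f₁ x ≤ M) (hM0 : 0 ≤ M) :
    f 0 ≤ |f ℓ| + M / lam := by
  have h1 := (h.const_mul (-1)).exp_mul_le_of_le_flux (m := -M) hℓ hlam hε fun x hx => by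
    linarith [hM x hx]
  set q := Real.exp (-(lam / ε) * ℓ)
  have hq : 0 < q := Real.exp_pos _
  have hq1 : q < 1 := exp_neg_div_mul_lt_one hlam hε hℓ
  have h2 : 0 ≤ M / lam := by positivity
  rw [neg_div] at h1
  have h3 : q * f ℓ ≤ |f ℓ| := by
    calc q * f ℓ ≤ q * |f ℓ| := mul_le_mul_of_nonneg_left (le_abs_self _) hq.le
      _ ≤ |f ℓ| := mul_le_of_le_one_left (abs_nonneg _) hq1.le
  nlinarith

namespace StarNetwork

theorem inner_mem {ι : Type*} [DecidableEq ι] (N : StarNetwork ι) (i : ι) :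
    N.inner i ∈ Icc 0 (N.length i) := by
  have := (N.length_pos i).le
  unfold StarNetwork.inner
  split_ifs
  · exact right_mem_Icc.2 this
  · exact left_mem_Icc.2 this

variable {ι : Type*} [Fintype ι] [DecidableEq ι]

/-- A maximum principle for the values at the inner node. -/
theorem exists_node_upper_bound (N : StarNetwork ι) {lam : ι → ℝ} (hlam : ∀ i, 0 < lam i)
    {K : ι → ι → ℝ} (hK : ∀ i j, 0 ≤ K i j)
    (hKpos : ∀ i ∈ N.incoming, ∃ j, j ∉ N.incoming ∧ 0 < K i j) {b c C : ℝ} (hb : 0 ≤ b)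
    (hc : 0 ≤ c) (hC : 0 ≤ C) : ∃ D, 0 ≤ D ∧ ∀ d : ι → ℝ,
      (∀ i ∈ N.incoming, 0 ≤ d i → ∑ j, K i j * (d i - d j) ≤ C) →
      (∀ i ∉ N.incoming, ∀ R, 0 ≤ R → ∑ j, K i j * (d j - d i) ≤ R →
        d i ≤ b + (c + R) / lam i) →
      ∀ i, d i ≤ D := by
  have hP : ∀ i, 0 ≤ b + c / lam i := fun i => by have := hlam i; positivity
  have hQ : ∀ i j, 0 ≤ b + (c + (∑ k, K j k) * (C / K i j)) / lam j + C / K i j := fun i j => by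
    have := hlam j
    have h1 := hK i j
    have h2 : 0 ≤ ∑ k, K j k := Finset.sum_nonneg fun k _ => hK j k
    positivity
  -- The first sum covers a maximum on an outgoing arc, where `R = 0`. The second covers a maximum
  -- on an incoming arc `i` with outgoing neighbour `j`; terms with `K i j = 0` are harmless since
  -- division by zero gives `0`.
  refine ⟨∑ i, (b + c / lam i) +
    ∑ i, ∑ j, (b + (c + (∑ k, K j k) * (C / K i j)) / lam j + C / K i j),
    add_nonneg (Finset.sum_nonneg fun i _ => hP i)
      (Finset.sum_nonneg fun i _ => Finset.sum_nonneg fun j _ => hQ i j), ?_⟩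
  intro d hin hout i₀
  have hD1 : ∀ i, b + c / lam i ≤ ∑ i, (b + c / lam i) := fun i =>
    Finset.single_le_sum (f := fun i => b + c / lam i) (fun j _ => hP j) (Finset.mem_univ i)
  have hD2 : ∀ i j, b + (c + (∑ k, K j k) * (C / K i j)) / lam j + C / K i j ≤
      ∑ i, ∑ j, (b + (c + (∑ k, K j k) * (C / K i j)) / lam j + C / K i j) := fun i j =>
    (Finset.single_le_sum
      (f := fun j => b + (c + (∑ k, K j k) * (C / K i j)) / lam j + C / K i j)
      (fun j _ => hQ i j) (Finset.mem_univ j)).trans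
    (Finset.single_le_sum
      (f := fun i => ∑ j, (b + (c + (∑ k, K j k) * (C / K i j)) / lam j + C / K i j))
      (fun i _ => Finset.sum_nonneg fun j _ => hQ i j) (Finset.mem_univ i))
  have hD1' : 0 ≤ ∑ i, (b + c / lam i) := Finset.sum_nonneg fun i _ => hP i
  have hD2' : 0 ≤ ∑ i, ∑ j, (b + (c + (∑ k, K j k) * (C / K i j)) / lam j + C / K i j) :=
    Finset.sum_nonneg fun i _ => Finset.sum_nonneg fun j _ => hQ i j
  obtain ⟨i, -, hi⟩ := Finset.exists_max_image Finset.univ d ⟨i₀, Finset.mem_univ _⟩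
  have hmax : ∀ j, d j ≤ d i := fun j => hi j (Finset.mem_univ j)
  refine (hmax i₀).trans ?_
  rcases lt_or_ge (d i) 0 with hneg | hpos
  · linarith
  by_cases him : i ∈ N.incoming
  · obtain ⟨j, hj, hKij⟩ := hKpos i him
    -- At a maximum all terms of the sum are nonnegative, so each is at most `C`. Hence `d j` is
    -- within `C / K i j` of the maximum, and this also bounds the flux entering arc `j`.
    have h1 : K i j * (d i - d j) ≤ C :=
      (Finset.single_le_sum (f := fun j => K i j * (d i - d j))
        (fun k _ => mul_nonneg (hK i k) (sub_nonneg.2 (hmax k))) (Finset.mem_univ j)).trans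
        (hin i him hpos)
    have h2 : d i - d j ≤ C / K i j := by
      rw [le_div_iff₀ hKij]; linarith
    have h3 : ∑ k, K j k * (d k - d j) ≤ (∑ k, K j k) * (C / K i j) := by
      rw [Finset.sum_mul]
      refine Finset.sum_le_sum fun k _ => mul_le_mul_of_nonneg_left ?_ (hK j k)
      linarith [hmax k]
    have h4 := hout j hj _ (mul_nonneg (Finset.sum_nonneg fun k _ => hK j k)
      (div_nonneg hC hKij.le)) h3
    have h5 := hD2 i j
    linarith
  · have h1 := hout i him 0 le_rfl (Finset.sum_nonpos fun j _ =>
      mul_nonpos_of_nonneg_of_nonpos (hK i j) (sub_nonpos.2 (hmax j)))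
    rw [add_zero] at h1
    linarith [hD1 i]

section Stationary

variable {N : StarNetwork ι} {lam : ι → ℝ} {K : ι → ι → ℝ} {b c ε ε₀ : ℝ}

/-- Hypotheses satisfied by the solution at a fixed time, stated for the three functions so that
they are invariant under `f ↦ -f`. -/
structure NodeState (N : StarNetwork ι) (lam : ι → ℝ) (K : ι → ι → ℝ) (b c ε : ℝ)
    (f f₁ f₂ : ι → ℝ → ℝ) : Prop where
  prim : ∀ i, IsPrimitive (N.length i) (f i) (f₁ i)
  prim₁ : ∀ i, IsPrimitive (N.length i) (f₁ i) (f₂ i)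
  transmission : ∀ i, N.beta i * (-lam i * f i (N.inner i) + ε * f₁ i (N.inner i)) =
    ∑ j, K i j * (f j (N.inner j) - f i (N.inner i))
  incoming : ∀ i ∈ N.incoming, |f i 0| ≤ b
  outgoing : ∀ i ∉ N.incoming, |f i (N.length i)| ≤ b
  flux : ∀ i, ∫ x in Ioo 0 (N.length i), |lam i * f₁ i x - ε * f₂ i x| ≤ c

namespace NodeState

variable {f f₁ f₂ : ι → ℝ → ℝ}

theorem neg (h : NodeState N lam K b c ε f f₁ f₂) :
    NodeState N lam K b c ε (fun i x => -1 * f i x) (fun i x => -1 * f₁ i x)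
      (fun i x => -1 * f₂ i x) where
  prim i := (h.prim i).const_mul (-1)
  prim₁ i := (h.prim₁ i).const_mul (-1)
  transmission i := by
    have := h.transmission i
    calc _ = -(N.beta i * (-lam i * f i (N.inner i) + ε * f₁ i (N.inner i))) := by ring
      _ = _ := by
        rw [this, ← Finset.sum_neg_distrib]
        exact Finset.sum_congr rfl fun j _ => by ring
  incoming i hi := by simpa using h.incoming i hi
  outgoing i hi := by simpa using h.outgoing i hi
  flux i := by
    refine le_trans (le_of_eq (integral_congr_ae (ae_of_all _ fun x => ?_))) (h.flux i)
    simp only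
    rw [← abs_neg]
    congr 1
    ring

theorem abs_flux_sub_le (h : NodeState N lam K b c ε f f₁ f₂) (i : ι) {x y : ℝ}
    (hx : x ∈ Icc 0 (N.length i)) (hy : y ∈ Icc 0 (N.length i)) :
    |(lam i * f i y - ε * f₁ i y) - (lam i * f i x - ε * f₁ i x)| ≤ c :=
  ((((h.prim i).const_mul (lam i)).sub ((h.prim₁ i).const_mul ε)).abs_sub_le
    (N.length_pos i) hx hy).trans (h.flux i)

/-- The transmission condition equates the node flux with `∑ K i j (d i - d j)` on incoming arcs and
with its negative on outgoing arcs. The two exponential comparisons then supply the hypotheses of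
the maximum principle. -/
theorem le_of_node_upper_bound (h : NodeState N lam K b c ε f f₁ f₂) (hlam : ∀ i, 0 < lam i)
    (hε : 0 < ε) (hεε₀ : ε ≤ ε₀) (hc : 0 ≤ c) {C D : ℝ}
    (hC : ∀ i, c + lam i * b / (1 - Real.exp (-(lam i / ε₀) * N.length i)) ≤ C)
    (hD : ∀ d : ι → ℝ,
      (∀ i ∈ N.incoming, 0 ≤ d i → ∑ j, K i j * (d i - d j) ≤ C) →
      (∀ i ∉ N.incoming, ∀ R, 0 ≤ R → ∑ j, K i j * (d j - d i) ≤ R →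
        d i ≤ b + (c + R) / lam i) → ∀ i, d i ≤ D) (i : ι) :
    f i (N.inner i) ≤ D := by
  refine hD (fun i => f i (N.inner i)) (fun i hi hpos => ?_) (fun i hi R hR hsum => ?_) i
  · have hℓ := N.length_pos i
    have hfl := h.transmission i
    have hsum : ∑ j, K i j * (f i (N.inner i) - f j (N.inner j)) =
        lam i * f i (N.length i) - ε * f₁ i (N.length i) := by
      have : ∑ j, K i j * (f i (N.inner i) - f j (N.inner j)) =
          -∑ j, K i j * (f j (N.inner j) - f i (N.inner i)) := by
        rw [← Finset.sum_neg_distrib]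
        exact Finset.sum_congr rfl fun j _ => by ring
      rw [this, ← hfl]
      simp only [StarNetwork.inner, beta, hi, if_true]
      ring
    rw [hsum]
    have hpos' : 0 ≤ f i (N.length i) := by
      simpa only [StarNetwork.inner, hi, if_true] using hpos
    -- The flux varies by at most `c`, so its node value minus `c` is a lower bound on the whole
    -- arc.
    have h1 := (h.prim i).flux_lower_bound
      (m := lam i * f i (N.length i) - ε * f₁ i (N.length i) - c) hℓ (hlam i) hε hεε₀
      (fun x hx => by
        have := (abs_le.1 (h.abs_flux_sub_le i hx (right_mem_Icc.2 hℓ.le))).2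
        linarith) hpos'
    have hε₀ := hε.trans_le hεε₀
    have hq₀ : Real.exp (-(lam i / ε₀) * N.length i) < 1 := 
      exp_neg_div_mul_lt_one (hlam i) hε₀ hℓ
    have h2 : lam i * |f i 0| / (1 - Real.exp (-(lam i / ε₀) * N.length i)) ≤
        lam i * b / (1 - Real.exp (-(lam i / ε₀) * N.length i)) :=
      div_le_div_of_nonneg_right
        (mul_le_mul_of_nonneg_left (h.incoming i hi) (hlam i).le) (by linarith)
    linarith [hC i]
  · have hℓ := N.length_pos i
    have hfl := h.transmission i
    simp only [StarNetwork.inner, hi, if_false] at hsum hfl ⊢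
    simp only [beta, hi, if_false] at hfl
    have h1 := (h.prim i).left_value_upper_bound (M := c + R) hℓ (hlam i) hε
      (fun x hx => by
        have := (abs_le.1 (h.abs_flux_sub_le i (left_mem_Icc.2 hℓ.le) hx)).2
        linarith) (add_nonneg hc hR)
    linarith [h.outgoing i hi]

end NodeState

/-- Bounds for the solution at a fixed time, uniform in the viscosity. -/
theorem exists_nodeState_bound (N : StarNetwork ι) {lam : ι → ℝ} (hlam : ∀ i, 0 < lam i)
    {K : ι → ι → ℝ} (hK : ∀ i j, 0 ≤ K i j)
    (hKpos : ∀ i ∈ N.incoming, ∃ j, j ∉ N.incoming ∧ 0 < K i j) {b c ε₀ : ℝ} (hb : 0 ≤ b)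
    (hc : 0 ≤ c) (hε₀ : 0 < ε₀) : ∃ A, 0 ≤ A ∧ ∀ ε, 0 < ε → ε ≤ ε₀ → ∀ f f₁ f₂ : ι → ℝ → ℝ,
      NodeState N lam K b c ε f f₁ f₂ →
      ∀ i, (∀ x ∈ Icc 0 (N.length i), |f i x| ≤ A) ∧
        ∫ x in Ioo 0 (N.length i), |f₁ i x| ≤ A := by
  have hterm : ∀ i, 0 ≤ lam i * b / (1 - Real.exp (-(lam i / ε₀) * N.length i)) := fun i => by
    have h1 := hlam i
    have h2 := N.length_pos i
    have hq₀ : Real.exp (-(lam i / ε₀) * N.length i) < 1 := 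
      exp_neg_div_mul_lt_one h1 hε₀ h2
    exact div_nonneg (by positivity) (by linarith)
  set C := c + ∑ i, lam i * b / (1 - Real.exp (-(lam i / ε₀) * N.length i)) with hC
  have hCi : ∀ i, c + lam i * b / (1 - Real.exp (-(lam i / ε₀) * N.length i)) ≤ C := fun i =>
    add_le_add le_rfl (Finset.single_le_sum
      (f := fun i => lam i * b / (1 - Real.exp (-(lam i / ε₀) * N.length i)))
      (fun j _ => hterm j) (Finset.mem_univ i))
  obtain ⟨D, hD0, hD⟩ := exists_node_upper_bound N hlam hK hKpos hb hc
    (add_nonneg hc (Finset.sum_nonneg fun i _ => hterm i) : 0 ≤ C)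
  have hSK : ∀ i, 0 ≤ ∑ j, K i j := fun i => Finset.sum_nonneg fun j _ => hK i j
  have hE : ∀ i, 0 ≤ (lam i * (D + b) + (∑ j, K i j) * (2 * D) + 2 * c) / lam i := fun i => by
    have := hlam i
    have := hSK i
    positivity
  refine ⟨D + ∑ i, (lam i * (D + b) + (∑ j, K i j) * (2 * D) + 2 * c) / lam i,
    add_nonneg hD0 (Finset.sum_nonneg fun i _ => hE i), ?_⟩
  intro ε hε hεε₀ f f₁ f₂ h i
  have hℓ := N.length_pos i
  -- Lower bounds follow by applying the upper bound to `-f`.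
  have hnode : ∀ j, |f j (N.inner j)| ≤ D := fun j => by
    have h1 := h.le_of_node_upper_bound hlam hε hεε₀ hc hCi hD j
    have h2 := h.neg.le_of_node_upper_bound hlam hε hεε₀ hc hCi hD j
    exact abs_le.2 ⟨by linarith, h1⟩
  have hend : |f i (N.length i)| ≤ D + b := by
    by_cases hi : i ∈ N.incoming
    · have := hnode i
      simp only [StarNetwork.inner, hi, if_true] at this
      linarith
    · linarith [h.outgoing i hi]
  have hfluxN : |lam i * f i (N.inner i) - ε * f₁ i (N.inner i)| ≤ (∑ j, K i j) * (2 * D) := by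
    have e : |lam i * f i (N.inner i) - ε * f₁ i (N.inner i)| =
        |∑ j, K i j * (f j (N.inner j) - f i (N.inner i))| := by
      rw [← h.transmission i, abs_mul, ← abs_neg]
      have : |N.beta i| = 1 := by unfold beta; split_ifs <;> simp
      rw [this, one_mul]
      congr 1
      ring
    rw [e, Finset.sum_mul]
    refine (Finset.abs_sum_le_sum_abs _ _).trans (Finset.sum_le_sum fun j _ => ?_)
    rw [abs_mul, abs_of_nonneg (hK i j)]
    refine mul_le_mul_of_nonneg_left ((abs_sub _ _).trans ?_) (hK i j)
    linarith [hnode i, hnode j]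
  have hflux : |lam i * f i (N.length i) - ε * f₁ i (N.length i)| ≤
      (∑ j, K i j) * (2 * D) + c := by
    have h1 := h.abs_flux_sub_le i (N.inner_mem i) (right_mem_Icc.2 hℓ.le)
    have h2 := abs_sub_abs_le_abs_sub (lam i * f i (N.length i) - ε * f₁ i (N.length i))
      (lam i * f i (N.inner i) - ε * f₁ i (N.inner i))
    linarith
  have hder : ε * |f₁ i (N.length i)| ≤ lam i * (D + b) + ((∑ j, K i j) * (2 * D) + c) := by
    have h1 : ε * |f₁ i (N.length i)| = |lam i * f i (N.length i) -
        (lam i * f i (N.length i) - ε * f₁ i (N.length i))| := by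
      rw [sub_sub_cancel, abs_mul, abs_of_pos hε]
    rw [h1]
    refine (abs_sub _ _).trans (add_le_add ?_ hflux)
    rw [abs_mul, abs_of_pos (hlam i)]
    exact mul_le_mul_of_nonneg_left hend (hlam i).le
  -- The first order equation for `f₁` needs only `ε |f₁|` at the right end, which stays bounded
  -- even if `f₁` itself blows up as `ε → 0`.
  have hode := integral_abs_le_of_ode hℓ (hlam i) hε (h.prim₁ i)
  have hfl : ∫ x in Ioo 0 (N.length i), |-(lam i * f₁ i x) + ε * f₂ i x| ≤ c := by
    refine le_trans (le_of_eq (integral_congr_ae (ae_of_all _ fun x => ?_))) (h.flux i)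
    simp only
    rw [← abs_neg]
    congr 1
    ring
  have hx : ∫ x in Ioo 0 (N.length i), |f₁ i x| ≤
      (lam i * (D + b) + (∑ j, K i j) * (2 * D) + 2 * c) / lam i := by
    rw [le_div_iff₀ (hlam i)]
    linarith
  have hs := Finset.single_le_sum
    (f := fun i => (lam i * (D + b) + (∑ j, K i j) * (2 * D) + 2 * c) / lam i)
    (fun j _ => hE j) (Finset.mem_univ i)
  refine ⟨fun x hxm => ?_, by linarith⟩
  have h1 := (h.prim i).abs_sub_le hℓ (N.inner_mem i) hxm
  have h2 := abs_sub_abs_le_abs_sub (f i x) (f i (N.inner i))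
  linarith [hnode i]

end Stationary

end StarNetwork

/-! ### Total variation in space-time. -/

namespace IsTest2

variable {ℓ T : ℝ} {φ : ℝ × ℝ → ℝ}

theorem hasDerivAt_fst {U : Set (ℝ × ℝ)} (h : IsTest2 U φ) (x t : ℝ) :
    HasDerivAt (fun x => φ (x, t)) (fderiv ℝ φ (x, t) (1, 0)) x :=
  ((h.contDiff.differentiable (by simp)) (x, t)).hasFDerivAt.comp_hasDerivAt x
    ((hasDerivAt_id x).prodMk (hasDerivAt_const x t))

theorem hasDerivAt_snd {U : Set (ℝ × ℝ)} (h : IsTest2 U φ) (x t : ℝ) :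
    HasDerivAt (fun t => φ (x, t)) (fderiv ℝ φ (x, t) (0, 1)) t :=
  ((h.contDiff.differentiable (by simp)) (x, t)).hasFDerivAt.comp_hasDerivAt t
    ((hasDerivAt_const t x).prodMk (hasDerivAt_id t))

theorem continuous_fderiv_apply {U : Set (ℝ × ℝ)} (h : IsTest2 U φ) (e : ℝ × ℝ) :
    Continuous (fun p => fderiv ℝ φ p e) :=
  (h.contDiff.continuous_fderiv (by simp)).clm_apply continuous_const

theorem exists_abs_fderiv_apply_le {U : Set (ℝ × ℝ)} (h : IsTest2 U φ) (e : ℝ × ℝ) :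
    ∃ M, ∀ p, |fderiv ℝ φ p e| ≤ M :=
  (h.hasCompactSupport.fderiv_apply (𝕜 := ℝ) e).exists_bound_of_continuous
    (h.continuous_fderiv_apply e)

theorem apply_eq_zero {U : Set (ℝ × ℝ)} (h : IsTest2 U φ) {p : ℝ × ℝ} (hp : p ∉ U) : φ p = 0 :=
  image_eq_zero_of_notMem_tsupport fun hm => hp (h.tsupport_subset hm)

theorem isTest1_slice (h : IsTest2 (Ioo 0 ℓ ×ˢ Ioo 0 T) φ) (t : ℝ) :
    IsTest1 ℓ (fun x => φ (x, t)) := by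
  have hsub : tsupport (fun x => φ (x, t)) ⊆ (fun x => (x, t)) ⁻¹' tsupport φ :=
    tsupport_comp_subset_preimage φ (by fun_prop : Continuous fun x : ℝ => (x, t))
  refine ⟨h.contDiff.comp (by fun_prop), ?_, fun x hx => (h.tsupport_subset (hsub hx)).1⟩
  refine HasCompactSupport.of_support_subset_isCompact
    (h.hasCompactSupport.isCompact.image continuous_fst) fun x hx => ?_
  exact ⟨(x, t), hsub (subset_tsupport _ hx), rfl⟩

end IsTest2

section TotalVariation

variable {ℓ T A C : ℝ} {U φ ψ : ℝ × ℝ → ℝ}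

theorem Continuous.integrableOn_Ioo_prod_Ioo (hU : Continuous U) (ℓ T : ℝ) :
    IntegrableOn U (Ioo 0 ℓ ×ˢ Ioo 0 T) :=
  (hU.continuousOn.integrableOn_compact (isCompact_Icc.prod isCompact_Icc)).mono_set
    (prod_mono Ioo_subset_Icc_self Ioo_subset_Icc_self)

theorem setIntegral_Ioo_prod_Ioo (hU : Continuous U) (ℓ T : ℝ) :
    ∫ p in Ioo 0 ℓ ×ˢ Ioo 0 T, U p = ∫ t in Ioo 0 T, ∫ x in Ioo 0 ℓ, U (x, t) := by
  have h := hU.integrableOn_Ioo_prod_Ioo ℓ T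
  rw [IntegrableOn, Measure.volume_eq_prod, ← Measure.prod_restrict] at h
  rw [Measure.volume_eq_prod, ← Measure.prod_restrict, integral_prod_symm _ h]

theorem integral_mul_fderiv_fst_le (hT : 0 < T) (hU : Continuous U)
    (hA : ∀ t ∈ Ioo 0 T, ∀ φ, IsTest1 ℓ φ → (∀ x, |φ x| ≤ 1) →
      ∫ x in Ioo 0 ℓ, U (x, t) * deriv φ x ≤ A)
    (hφ : IsTest2 (Ioo 0 ℓ ×ˢ Ioo 0 T) φ) (h1 : ∀ p, |φ p| ≤ 1) :
    ∫ p in Ioo 0 ℓ ×ˢ Ioo 0 T, U p * fderiv ℝ φ p (1, 0) ≤ T * A := by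
  have hc : Continuous fun p => U p * fderiv ℝ φ p (1, 0) := hU.mul (hφ.continuous_fderiv_apply _)
  rw [setIntegral_Ioo_prod_Ioo hc]
  have hi := hc.integrableOn_Ioo_prod_Ioo ℓ T
  rw [IntegrableOn, Measure.volume_eq_prod, ← Measure.prod_restrict] at hi
  refine (setIntegral_mono_on (g := fun _ => A) hi.integral_prod_right (by simp)
    measurableSet_Ioo fun t ht => ?_).trans (le_of_eq ?_)
  · have := hA t ht _ (hφ.isTest1_slice t) fun x => h1 (x, t)
    simpa only [(hφ.hasDerivAt_fst _ t).deriv] using this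
  · simp [hT.le]

/-- This is integration by parts in `t` for a function with no pointwise `t`-derivative. The
integral of `U ∂ₜψ` is compared with the pairing of `U` and `ψ`, which vanishes at both ends;
Lipschitz continuity in `L¹` controls the discrepancy. -/
theorem integral_mul_fderiv_snd_le (hℓ : 0 < ℓ) (hT : 0 < T) (hU : Continuous U)
    (hC : ∀ s ∈ Icc 0 T, ∀ t ∈ Icc 0 T, ∫ x in Ioo 0 ℓ, |U (x, s) - U (x, t)| ≤ C * |s - t|)
    (hψ : IsTest2 (Ioo 0 ℓ ×ˢ Ioo 0 T) ψ) (h1 : ∀ p, |ψ p| ≤ 1) :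
    ∫ p in Ioo 0 ℓ ×ˢ Ioo 0 T, U p * fderiv ℝ ψ p (0, 1) ≤ T * C := by
  have hψc := hψ.contDiff.continuous
  have hψt := hψ.continuous_fderiv_apply (0, 1)
  have hIoo : ∀ (f : ℝ → ℝ), ∫ x in Ioo 0 ℓ, f x = ∫ x in (0 : ℝ)..ℓ, f x := fun f => by
    rw [← integral_Ioc_eq_integral_Ioo, intervalIntegral.integral_of_le hℓ.le]
  have hUψ : Continuous fun p => U p * fderiv ℝ ψ p (0, 1) := hU.mul hψt
  rw [setIntegral_Ioo_prod_Ioo hUψ]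
  set D : ℝ → ℝ := fun t => ∫ x in (0 : ℝ)..ℓ, U (x, t) * fderiv ℝ ψ (x, t) (0, 1) with hD
  set G : ℝ → ℝ := fun t => ∫ x in (0 : ℝ)..ℓ, U (x, t) * ψ (x, t) with hG
  have hDc : Continuous D := intervalIntegral.continuous_parametric_intervalIntegral_of_continuous'
    (f := fun t x => U (x, t) * fderiv ℝ ψ (x, t) (0, 1))
    ((hU.comp continuous_swap).mul (hψt.comp continuous_swap)) _ _
  have hGc : Continuous G := intervalIntegral.continuous_parametric_intervalIntegral_of_continuous'
    (f := fun t x => U (x, t) * ψ (x, t))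
    ((hU.comp continuous_swap).mul (hψc.comp continuous_swap)) _ _
  have hDint : ∀ t, HasDerivAt (fun t => ∫ s in (0 : ℝ)..t, D s) (D t) t := fun t =>
    intervalIntegral.integral_hasDerivAt_right (hDc.intervalIntegrable _ _)
      (hDc.stronglyMeasurableAtFilter _ _) hDc.continuousAt
  have hG0 : ∀ t, t ∉ Ioo 0 T → G t = 0 := fun t ht => by
    simp only [hG]
    refine intervalIntegral.integral_zero_ae (ae_of_all _ fun x _ => ?_)
    rw [hψ.apply_eq_zero fun h => ht h.2, mul_zero]
  obtain ⟨M, hM⟩ := hψ.exists_abs_fderiv_apply_le (0, 1)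
  have hUx : ∀ t, Continuous fun x => U (x, t) := fun t => hU.comp (by fun_prop)
  have hψx : ∀ t, Continuous fun x => ψ (x, t) := fun t => hψc.comp (by fun_prop)
  -- With `U` frozen at time `t` only the smooth factor varies, so the derivative at `s = t` is
  -- exactly `D t`.
  have hpair : ∀ t, HasDerivAt (fun s => ∫ x in (0 : ℝ)..ℓ, U (x, t) * ψ (x, s)) (D t) t :=
    fun t => (intervalIntegral.hasDerivAt_integral_of_dominated_loc_of_deriv_le
      (F' := fun s x => U (x, t) * fderiv ℝ ψ (x, s) (0, 1)) (bound := fun x => |U (x, t)| * M)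
      (s := univ) univ_mem
      (Filter.Eventually.of_forall fun s => ((hUx t).mul (hψx s)).aestronglyMeasurable)
      (((hUx t).mul (hψx t)).intervalIntegrable _ _)
      ((hUx t).mul (hψt.comp (by fun_prop : Continuous fun x : ℝ => (x, t)))).aestronglyMeasurable
      (ae_of_all _ fun x _ s _ => by
        rw [Real.norm_eq_abs, abs_mul]
        exact mul_le_mul_of_nonneg_left (hM _) (abs_nonneg _))
      (((hUx t).abs.mul continuous_const).intervalIntegrable _ _)
      (ae_of_all _ fun x _ s _ => (hψ.hasDerivAt_snd x s).const_mul _)).2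
  -- Replacing `G` by the frozen pairing leaves a function with derivative `0` at `t`. The error
  -- from unfreezing `U` is at most `C (z - t)` since `|ψ| ≤ 1`, so the right slopes are
  -- asymptotically at most `C`.
  have key := image_le_of_liminf_slope_right_le_deriv_boundary
    (f := fun t => (∫ s in (0 : ℝ)..t, D s) - G t) (a := 0) (b := T) (B := fun t => C * t)
    (B' := fun _ => C)
    (((continuous_iff_continuousAt.2 fun t => (hDint t).continuousAt).sub hGc).continuousOn)
    (by simp [hG0 0]) (by fun_prop)
    (fun t _ => by simpa using ((hasDerivAt_id t).const_mul C).hasDerivWithinAt)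
    (fun t ht r hr => ?_) (right_mem_Icc.2 hT.le)
  · simp only [hG0 T (by simp), sub_zero, intervalIntegral.integral_of_le hT.le,
      integral_Ioc_eq_integral_Ioo] at key
    simp only [hIoo]
    rw [mul_comm T C]
    exact key
  have hR : HasDerivWithinAt (fun s => (∫ s in (0 : ℝ)..s, D s) -
      ∫ x in (0 : ℝ)..ℓ, U (x, t) * ψ (x, s)) (D t - D t) (Ioi t) t :=
    ((hDint t).sub (hpair t)).hasDerivWithinAt
  rw [hasDerivWithinAt_iff_tendsto_slope' (by simp), sub_self] at hR
  have hev := hR.eventually (gt_mem_nhds (sub_pos.2 hr))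
  refine ((hev.and (Ioo_mem_nhdsGT ht.2)).mono fun z hz => ?_).frequently
  obtain ⟨hz1, hz2⟩ := hz
  have hzt : 0 < z - t := sub_pos.2 hz2.1
  have hincr : -(G z - ∫ x in (0 : ℝ)..ℓ, U (x, t) * ψ (x, z)) ≤ C * (z - t) := by
    have h2 := hC z ⟨ht.1.trans hz2.1.le, hz2.2.le⟩ t ⟨ht.1, ht.2.le⟩
    rw [abs_of_pos hzt] at h2
    refine le_trans ?_ h2
    have cz : Continuous fun x => U (x, z) * ψ (x, z) := (hUx z).mul (hψx z)
    have ct : Continuous fun x => U (x, t) * ψ (x, z) := (hUx t).mul (hψx z)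
    simp only [hIoo, hG]
    rw [← intervalIntegral.integral_sub (cz.intervalIntegrable _ _) (ct.intervalIntegrable _ _)]
    refine (neg_le_abs _).trans ((intervalIntegral.abs_integral_le_integral_abs hℓ.le).trans ?_)
    refine intervalIntegral.integral_mono_on hℓ.le ?_ ?_ fun x _ => ?_
    · exact (cz.sub ct).abs.intervalIntegrable _ _
    · exact ((hUx z).sub (hUx t)).abs.intervalIntegrable _ _
    · rw [← sub_mul, abs_mul]
      exact mul_le_of_le_one_right (abs_nonneg _) (h1 _)
  rw [slope_def_field, div_lt_iff₀ hzt] at hz1 ⊢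
  simp only [hG] at hincr ⊢
  linarith

/-- A continuous function of `(x, t)` with `x`-variation at most `A` on each slice and which is
`C`-Lipschitz in `t` for the `L¹` norm has bounded variation. -/
theorem totalVariation2_le (hℓ : 0 < ℓ) (hT : 0 < T) (hU : Continuous U)
    (hA : ∀ t ∈ Ioo 0 T, ∀ φ, IsTest1 ℓ φ → (∀ x, |φ x| ≤ 1) →
      ∫ x in Ioo 0 ℓ, U (x, t) * deriv φ x ≤ A)
    (hC : ∀ s ∈ Icc 0 T, ∀ t ∈ Icc 0 T, ∫ x in Ioo 0 ℓ, |U (x, s) - U (x, t)| ≤ C * |s - t|) :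
    totalVariation2 (Ioo 0 ℓ ×ˢ Ioo 0 T) U ≤ ENNReal.ofReal (T * A + T * C) := by
  refine iSup_le fun φ => iSup_le fun ψ => iSup_le fun hφ => iSup_le fun hψ => iSup_le fun h1 => ?_
  refine ENNReal.ofReal_le_ofReal ?_
  have c1 : Continuous fun p => U p * fderiv ℝ φ p (1, 0) := hU.mul (hφ.continuous_fderiv_apply _)
  have c2 : Continuous fun p => U p * fderiv ℝ ψ p (0, 1) := hU.mul (hψ.continuous_fderiv_apply _)
  simp only [mul_add]
  rw [integral_add (c1.integrableOn_Ioo_prod_Ioo ℓ T) (c2.integrableOn_Ioo_prod_Ioo ℓ T)]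
  refine add_le_add (integral_mul_fderiv_fst_le hT hU hA hφ fun p => ?_)
    (integral_mul_fderiv_snd_le hℓ hT hU hC hψ fun p => ?_)
  · exact abs_le_one_iff_mul_self_le_one.2 (by nlinarith [h1 p, sq_nonneg (ψ p)])
  · exact abs_le_one_iff_mul_self_le_one.2 (by nlinarith [h1 p, sq_nonneg (φ p)])

end TotalVariation

/-! ### From continuous curves in `W^{1,1}` to `BV` in space-time. -/

namespace MeasureTheory.Integrable

variable {α : Type*} [MeasurableSpace α] {μ : Measure α} {f g : α → ℝ}

theorem norm_toL1_sub_eq_toReal_eLpNorm (hf : Integrable f μ) (hg : Integrable g μ) :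
    ‖hf.toL1 f - hg.toL1 g‖ = (eLpNorm (fun x => f x - g x) 1 μ).toReal := by
  rw [← Integrable.toL1_sub, Integrable.toL1, Lp.norm_toLp]
  rfl

theorem norm_toL1_sub_eq_integral_abs (hf : Integrable f μ) (hg : Integrable g μ) :
    ‖hf.toL1 f - hg.toL1 g‖ = ∫ x, |f x - g x| ∂μ := by
  rw [← Integrable.toL1_sub, L1.norm_of_fun_eq_integral_norm]
  rfl

end MeasureTheory.Integrable

namespace W21

variable {ℓ : ℝ}

theorem norm_toL1_sub (f g : W21 ℓ) :
    ‖f.toL1 - g.toL1‖ = ∫ x in Ioo 0 ℓ, |f.toFun x - g.toFun x| :=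
  Integrable.norm_toL1_sub_eq_integral_abs f.integrableOn_toFun g.integrableOn_toFun

theorem norm_derL1_sub (f g : W21 ℓ) :
    ‖f.derL1 - g.derL1‖ = ∫ x in Ioo 0 ℓ, |f.der x - g.der x| :=
  Integrable.norm_toL1_sub_eq_integral_abs f.integrableOn_der g.integrableOn_der

theorem abs_toFun_sub_le (hℓ : 0 < ℓ) (f g : W21 ℓ) {x : ℝ} (hx : x ∈ Icc 0 ℓ) :
    |f.toFun x - g.toFun x| ≤ ℓ⁻¹ * ‖f.toL1 - g.toL1‖ + ‖f.derL1 - g.derL1‖ := by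
  rw [norm_toL1_sub, norm_derL1_sub]
  exact ((f.isPrimitive_toFun hℓ).sub (g.isPrimitive_toFun hℓ)).abs_le hℓ hx

theorem abs_toFun_le (hℓ : 0 < ℓ) (f : W21 ℓ) {x : ℝ} (hx : x ∈ Icc 0 ℓ) :
    |f.toFun x| ≤ ℓ⁻¹ * ‖f.toL1‖ + ‖f.derL1‖ := by
  have h0 : ‖f.toL1‖ = ∫ x in Ioo 0 ℓ, |f.toFun x| :=
    L1.norm_of_fun_eq_integral_norm f.integrableOn_toFun
  have h1 : ‖f.derL1‖ = ∫ x in Ioo 0 ℓ, |f.der x| :=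
    L1.norm_of_fun_eq_integral_norm f.integrableOn_der
  rw [h0, h1]
  exact (f.isPrimitive_toFun hℓ).abs_le hℓ hx

theorem integral_mul_deriv_le (f : W21 ℓ) {φ : ℝ → ℝ} (hφ : IsTest1 ℓ φ) (h1 : ∀ x, |φ x| ≤ 1) :
    ∫ x in Ioo 0 ℓ, f.toFun x * deriv φ x ≤ ∫ x in Ioo 0 ℓ, |f.der x| := by
  rw [f.hasWeakDeriv_toFun φ hφ]
  refine (neg_le_abs _).trans (abs_integral_le_integral_abs.trans ?_)
  refine integral_mono_of_nonneg (ae_of_all _ fun x => abs_nonneg _) f.integrableOn_der.abs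
    (ae_of_all _ fun x => ?_)
  simp only [abs_mul]
  exact mul_le_of_le_one_right (abs_nonneg _) (h1 x)

/-- The function of `(x, t)` defined by a continuous curve in `W^{1,1}` is continuous. -/
theorem continuous_toFun_projIcc (hℓ : 0 < ℓ) {T : ℝ} (hT : 0 ≤ T) {u : ℝ → W21 ℓ}
    (h0 : ContinuousOn (fun t => (u t).toL1) (Icc 0 T))
    (h1 : ContinuousOn (fun t => (u t).derL1) (Icc 0 T)) :
    Continuous fun p : ℝ × ℝ => (u (projIcc 0 T hT p.2)).toFun (projIcc 0 ℓ hℓ.le p.1) := by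
  have hx : ∀ t, Continuous fun x : ℝ => (u t).toFun (projIcc 0 ℓ hℓ.le x) := fun t =>
    (u t).continuousOn_toFun.comp_continuous (continuous_subtype_val.comp continuous_projIcc)
      fun x => (projIcc 0 ℓ hℓ.le x).2
  have hp : Continuous fun t : ℝ => (projIcc 0 T hT t : ℝ) :=
    continuous_subtype_val.comp continuous_projIcc
  have c0 : Continuous fun t : ℝ => (u (projIcc 0 T hT t)).toL1 :=
    h0.comp_continuous hp fun t => (projIcc 0 T hT t).2
  have c1 : Continuous fun t : ℝ => (u (projIcc 0 T hT t)).derL1 :=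
    h1.comp_continuous hp fun t => (projIcc 0 T hT t).2
  rw [continuous_iff_continuousAt]
  rintro ⟨x₀, t₀⟩
  have hlim : Tendsto (fun p : ℝ × ℝ =>
      ℓ⁻¹ * ‖(u (projIcc 0 T hT p.2)).toL1 - (u (projIcc 0 T hT t₀)).toL1‖ +
        ‖(u (projIcc 0 T hT p.2)).derL1 - (u (projIcc 0 T hT t₀)).derL1‖ +
        |(u (projIcc 0 T hT t₀)).toFun (projIcc 0 ℓ hℓ.le p.1) -
          (u (projIcc 0 T hT t₀)).toFun (projIcc 0 ℓ hℓ.le x₀)|) (𝓝 (x₀, t₀)) (𝓝 0) := by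
    have hc : Continuous (fun p : ℝ × ℝ =>
        ℓ⁻¹ * ‖(u (projIcc 0 T hT p.2)).toL1 - (u (projIcc 0 T hT t₀)).toL1‖ +
        ‖(u (projIcc 0 T hT p.2)).derL1 - (u (projIcc 0 T hT t₀)).derL1‖ +
        |(u (projIcc 0 T hT t₀)).toFun (projIcc 0 ℓ hℓ.le p.1) -
          (u (projIcc 0 T hT t₀)).toFun (projIcc 0 ℓ hℓ.le x₀)|) :=
      (((continuous_const.mul ((c0.comp continuous_snd).sub continuous_const).norm).add
        ((c1.comp continuous_snd).sub continuous_const).norm).add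
        (((hx _).comp continuous_fst).sub continuous_const).abs)
    simpa using hc.tendsto (x₀, t₀)
  refine tendsto_iff_dist_tendsto_zero.2 (squeeze_zero (fun _ => dist_nonneg) (fun p => ?_) hlim)
  rw [Real.dist_eq]
  refine (abs_sub_le _ ((u (projIcc 0 T hT t₀)).toFun (projIcc 0 ℓ hℓ.le p.1)) _).trans
    (add_le_add ?_ le_rfl)
  exact abs_toFun_sub_le hℓ _ _ (projIcc 0 ℓ hℓ.le p.1).2

end W21

theorem totalVariation2_congr {U : Set (ℝ × ℝ)} (hU : MeasurableSet U) {f g : ℝ × ℝ → ℝ}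
    (h : EqOn f g U) : totalVariation2 U f = totalVariation2 U g := by
  unfold totalVariation2
  refine iSup_congr fun φ => iSup_congr fun ψ => iSup_congr fun _ => iSup_congr fun _ =>
    iSup_congr fun _ => congrArg ENNReal.ofReal (setIntegral_congr_fun hU fun p hp => ?_)
  simp only [h hp]

/-- Bounds on the slices of a continuous curve in `W^{1,1}` bound its `BV` norm in space-time. -/
theorem memBV2_and_bvNorm2_le {ℓ T A C : ℝ} (hℓ : 0 < ℓ) (hT : 0 < T) {u : ℝ → W21 ℓ}
    (h0 : ContinuousOn (fun t => (u t).toL1) (Icc 0 T))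
    (h1 : ContinuousOn (fun t => (u t).derL1) (Icc 0 T))
    (hsup : ∀ t ∈ Ioo 0 T, ∀ x ∈ Icc 0 ℓ, |(u t).toFun x| ≤ A)
    (hder : ∀ t ∈ Ioo 0 T, ∫ x in Ioo 0 ℓ, |(u t).der x| ≤ A)
    (hlip : ∀ s ∈ Icc 0 T, ∀ t ∈ Icc 0 T, ‖(u s).toL1 - (u t).toL1‖ ≤ C * |s - t|) :
    MemBV2 (Ioo 0 ℓ ×ˢ Ioo 0 T) (fun p => (u p.2).toFun p.1) ∧
      bvNorm2 (Ioo 0 ℓ ×ˢ Ioo 0 T) (fun p => (u p.2).toFun p.1) ≤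
        volume (Ioo (0 : ℝ) ℓ ×ˢ Ioo (0 : ℝ) T) * ENNReal.ofReal A +
          ENNReal.ofReal (T * A + T * C) := by
  -- Projecting onto the closed rectangle gives a function continuous on the whole plane that agrees
  -- with the solution on the rectangle.
  set U : ℝ × ℝ → ℝ := fun p => (u (projIcc 0 T hT.le p.2)).toFun (projIcc 0 ℓ hℓ.le p.1) with hU
  have hUc : Continuous U := W21.continuous_toFun_projIcc hℓ hT.le h0 h1
  have hUeq : ∀ x ∈ Icc 0 ℓ, ∀ t ∈ Icc 0 T, U (x, t) = (u t).toFun x := fun x hx t ht => by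
    simp only [hU, projIcc_of_mem hℓ.le hx, projIcc_of_mem hT.le ht]
  have hm : MeasurableSet (Ioo (0 : ℝ) ℓ ×ˢ Ioo (0 : ℝ) T) :=
    measurableSet_Ioo.prod measurableSet_Ioo
  have heq : EqOn (fun p : ℝ × ℝ => (u p.2).toFun p.1) U (Ioo 0 ℓ ×ˢ Ioo 0 T) := fun p hp =>
    (hUeq p.1 (Ioo_subset_Icc_self hp.1) p.2 (Ioo_subset_Icc_self hp.2)).symm
  have hint : IntegrableOn (fun p : ℝ × ℝ => (u p.2).toFun p.1) (Ioo 0 ℓ ×ˢ Ioo 0 T) :=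
    (integrableOn_congr_fun heq hm).2 (hUc.integrableOn_Ioo_prod_Ioo ℓ T)
  have htv : totalVariation2 (Ioo 0 ℓ ×ˢ Ioo 0 T) (fun p => (u p.2).toFun p.1) ≤
      ENNReal.ofReal (T * A + T * C) := by
    rw [totalVariation2_congr hm heq]
    refine totalVariation2_le hℓ hT hUc (fun t ht φ hφ hφ1 => ?_) fun s hs t ht => ?_
    · refine le_trans (le_of_eq ?_) (((u t).integral_mul_deriv_le hφ hφ1).trans (hder t ht))
      exact setIntegral_congr_fun measurableSet_Ioo fun x hx => by
        simp only [hUeq x (Ioo_subset_Icc_self hx) t (Ioo_subset_Icc_self ht)]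
    · refine le_trans (le_of_eq ?_) (hlip s hs t ht)
      rw [W21.norm_toL1_sub]
      exact setIntegral_congr_fun measurableSet_Ioo fun x hx => by
        simp only [hUeq x (Ioo_subset_Icc_self hx) t ht, hUeq x (Ioo_subset_Icc_self hx) s hs]
  refine ⟨⟨hint, htv.trans_lt ENNReal.ofReal_lt_top⟩, add_le_add ?_ htv⟩
  have hb : ∀ᵐ p ∂volume.restrict (Ioo (0 : ℝ) ℓ ×ˢ Ioo (0 : ℝ) T),
      ‖(u p.2).toFun p.1‖ ≤ A := by
    rw [ae_restrict_iff' hm]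
    exact ae_of_all _ fun p hp => hsup p.2 hp.2 p.1 (Ioo_subset_Icc_self hp.1)
  simpa using eLpNorm_le_of_ae_bound (p := 1) hb

/-! ### Uniform bounds for the viscous solutions. -/

namespace StarNetwork

variable {ι : Type*} [Fintype ι] [DecidableEq ι] {N : StarNetwork ι} {lam : ι → ℝ}
  {K : ι → ι → ℝ} {B : ι → ℝ}

theorem IsSolution.norm_toL1_sub_le {ε : ℝ} {v : ∀ i, W21 (N.length i)} {T : ℝ}
    {u : ∀ i, ℝ → W21 (N.length i)} (hu : N.IsSolution lam K B ε v T u) {C : ℝ}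
    (hC : ∀ t ∈ Ico 0 T, ∑ i, ‖hu.velocity i t‖ ≤ C) (i : ι) {s t : ℝ} (hs : s ∈ Icc 0 T)
    (ht : t ∈ Icc 0 T) : ‖(u i s).toL1 - (u i t).toL1‖ ≤ C * |s - t| := by
  wlog hst : t ≤ s generalizing s t
  · rw [norm_sub_rev, abs_sub_comm]
    exact this ht hs (le_of_not_ge hst)
  rw [abs_of_nonneg (sub_nonneg.2 hst)]
  refine norm_image_sub_le_of_norm_deriv_right_le_segment (f := fun s => (u i s).toL1)
    (f' := hu.velocity i) (a := t) (b := s)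
    ((hu.continuous_W21 i).1.mono (Icc_subset_Icc ht.1 hs.2)) (fun r hr => ?_) (fun r hr => ?_)
    s (right_mem_Icc.2 hst)
  · have hrT : r < T := hr.2.trans_le hs.2
    exact (hu.hasDerivWithinAt i ⟨ht.1.trans hr.1, hrT.le⟩).mono_of_mem_nhdsWithin
      (mem_of_superset (Ico_mem_nhdsGE hrT) fun z hz => ⟨(ht.1.trans hr.1).trans hz.1, hz.2.le⟩)
  · exact (Finset.single_le_sum (f := fun i => ‖hu.velocity i r‖) (fun j _ => norm_nonneg _)
      (Finset.mem_univ i)).trans (hC r ⟨ht.1.trans hr.1, hr.2.trans_le hs.2⟩)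

theorem IsSolution.nodeState {ε : ℝ} {v : ∀ i, W21 (N.length i)} {T : ℝ}
    {u : ∀ i, ℝ → W21 (N.length i)} (hu : N.IsSolution lam K B ε v T u) {b c : ℝ}
    (hB : ∀ i, |B i| ≤ b) (hv : ∀ i, |(v i).toFun (N.length i)| ≤ b) {t : ℝ} (ht : t ∈ Icc 0 T)
    (hc : ∑ i, ‖hu.velocity i t‖ ≤ c) :
    NodeState N lam K b c ε (fun i => (u i t).toFun) (fun i => (u i t).der)
      (fun i => (u i t).der2) where
  prim i := (u i t).isPrimitive_toFun (N.length_pos i)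
  prim₁ i := (u i t).isPrimitive_der (N.length_pos i)
  transmission := hu.transmission t ht
  incoming i hi := by rw [hu.outer_incoming i hi t ht]; exact hB i
  outgoing i hi := by rw [hu.outer_outgoing i hi t ht]; exact hv i
  flux i := by
    refine le_trans (le_of_eq ?_) ((Finset.single_le_sum (f := fun i => ‖hu.velocity i t‖)
      (fun j _ => norm_nonneg _) (Finset.mem_univ i)).trans hc)
    rw [L1.norm_eq_integral_norm]
    refine integral_congr_ae ?_
    filter_upwards [hu.velocity_coeFn i t] with x hx
    rw [hx, Real.norm_eq_abs, ← abs_neg]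
    congr 1
    ring

/-- The outer values of an approximating sequence are bounded. -/
theorem Approximates.exists_abs_outer_le {ε : ℕ → ℝ} {u₀ : ι → ℝ → ℝ}
    {v : ℕ → ∀ i, W21 (N.length i)} (hv : N.Approximates lam K B ε u₀ v)
    (hu₀ : ∀ i, MemBV1 (N.length i) (u₀ i)) :
    ∃ b, ∀ n i, |(v n i).toFun (N.length i)| ≤ b := by
  obtain ⟨C, hC⟩ := hv.bound_der
  have hnorm : ∀ i, ∃ R, ∀ n, ‖(v n i).toL1‖ ≤ R := fun i => by
    -- A convergent sequence in `L¹` is bounded; together with the derivative bound this controls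
    -- pointwise values.
    have hlim : Tendsto (fun n => (v n i).toL1) atTop (𝓝 ((hu₀ i).1.toL1 (u₀ i))) := by
      rw [tendsto_iff_norm_sub_tendsto_zero]
      have h := (ENNReal.tendsto_toReal ENNReal.zero_ne_top).comp (hv.tendsto i)
      rw [ENNReal.toReal_zero] at h
      exact h.congr fun n => (Integrable.norm_toL1_sub_eq_toReal_eLpNorm
        (v n i).integrableOn_toFun (hu₀ i).1).symm
    obtain ⟨R, hR⟩ := (Metric.isBounded_range_of_tendsto _ hlim).exists_norm_le
    exact ⟨R, fun n => hR _ (mem_range_self n)⟩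
  choose R hR using hnorm
  have hnn : ∀ i, 0 ≤ (N.length i)⁻¹ * R i := fun i =>
    mul_nonneg (inv_nonneg.2 (N.length_pos i).le) ((norm_nonneg _).trans (hR i 0))
  refine ⟨∑ i, (N.length i)⁻¹ * R i + C, fun n i => ?_⟩
  have hℓ := N.length_pos i
  refine ((v n i).abs_toFun_le hℓ (right_mem_Icc.2 hℓ.le)).trans (add_le_add ?_ ?_)
  · exact (mul_le_mul_of_nonneg_left (hR i n) (inv_nonneg.2 hℓ.le)).trans
      (Finset.single_le_sum (f := fun i => (N.length i)⁻¹ * R i) (fun j _ => hnn j)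
        (Finset.mem_univ i))
  · exact (Finset.single_le_sum (f := fun i => ‖(v n i).derL1‖) (fun j _ => norm_nonneg _)
      (Finset.mem_univ i)).trans (hC n)

end StarNetwork

theorem proposition4p2 {ι : Type*} [Fintype ι] [DecidableEq ι] (N : StarNetwork ι)
    (lam : ι → ℝ) (hlam : ∀ i, 0 < lam i)
    (K : ι → ι → ℝ) (hK_nonneg : ∀ i j, 0 ≤ K i j) (hK_symm : ∀ i j, K i j = K j i)
    (hK_pos : ∀ i ∈ N.incoming, ∃ j, j ∉ N.incoming ∧ 0 < K i j)
    (B : ι → ℝ) (u₀ : ι → ℝ → ℝ) (hu₀ : ∀ i, MemBV1 (N.length i) (u₀ i))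
    (ε : ℕ → ℝ) (hε_pos : ∀ n, 0 < ε n) (hε_anti : Antitone ε)
    (hε_lim : Tendsto ε atTop (𝓝 0))
    (v : ℕ → ∀ i, W21 (N.length i)) (hv : N.Approximates lam K B ε u₀ v)
    (T : ℝ) (hT : 0 < T)
    (u : ℕ → ∀ i, ℝ → W21 (N.length i))
    (hu : ∀ n, N.IsSolution lam K B (ε n) (v n) T (u n)) :
    (∀ n i, MemBV2 (N.cylinder i T) (fun p => (u n i p.2).toFun p.1)) ∧
      (⨆ n, ∑ i, bvNorm2 (N.cylinder i T) (fun p => (u n i p.2).toFun p.1)) < ⊤ := by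
  obtain ⟨C₁, hC₁⟩ := hv.bound_der
  obtain ⟨C₂, hC₂⟩ := hv.bound_norm
  obtain ⟨b, hb⟩ := hv.exists_abs_outer_le hu₀
  set C := (∑ i, lam i) * C₁ + C₂
  have hvel : ∀ n, ∀ t ∈ Ico 0 T, ∑ i, ‖(hu n).velocity i t‖ ≤ C := fun n t ht =>
    ((hu n).sum_norm_velocity_le hlam hK_nonneg hK_symm (hε_pos n) ht).trans
      (((hu n).sum_norm_velocity_zero_le hlam (hε_pos n)).trans (add_le_add
        (mul_le_mul_of_nonneg_left (hC₁ n) (Finset.sum_nonneg fun i _ => (hlam i).le)) (hC₂ n)))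
  have hC0 : 0 ≤ C := (Finset.sum_nonneg fun i _ => norm_nonneg _).trans
    (hvel 0 0 ⟨le_rfl, hT⟩)
  obtain ⟨i₀, -⟩ := N.exists_incoming
  have hb0 : 0 ≤ b := (abs_nonneg _).trans (hb 0 i₀)
  -- The constant `b + ∑ |B i|` dominates the boundary data at both kinds of outer node.
  have hB : ∀ i, |B i| ≤ b + ∑ i, |B i| := fun i =>
    (Finset.single_le_sum (f := fun i => |B i|) (fun j _ => abs_nonneg _)
      (Finset.mem_univ i)).trans (le_add_of_nonneg_left hb0)
  have hBs : 0 ≤ ∑ i, |B i| := Finset.sum_nonneg fun i _ => abs_nonneg _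
  -- Since the viscosities decrease, `ε 0` bounds them all, and one constant `A` serves every `n`.
  obtain ⟨A, -, hA⟩ := StarNetwork.exists_nodeState_bound N hlam hK_nonneg hK_pos
    (add_nonneg hb0 hBs) hC0 (hε_pos 0)
  have hstate : ∀ n, ∀ t ∈ Ioo 0 T, ∀ i,
      (∀ x ∈ Icc 0 (N.length i), |(u n i t).toFun x| ≤ A) ∧
        ∫ x in Ioo 0 (N.length i), |(u n i t).der x| ≤ A := fun n t ht =>
    hA (ε n) (hε_pos n) (hε_anti (Nat.zero_le n)) _ _ _
      ((hu n).nodeState hB (fun i => (hb n i).trans (le_add_of_nonneg_right hBs))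
        (Ioo_subset_Icc_self ht) (hvel n t (Ioo_subset_Ico_self ht)))
  have hmain := fun n i => memBV2_and_bvNorm2_le (N.length_pos i) hT
    ((hu n).continuous_W21 i).1 ((hu n).continuous_W21 i).2.1
    (fun t ht => (hstate n t ht i).1) (fun t ht => (hstate n t ht i).2)
    fun s hs t ht => (hu n).norm_toL1_sub_le (hvel n) i hs ht
  refine ⟨fun n i => (hmain n i).1, ?_⟩
  refine lt_of_le_of_lt (iSup_le fun n => Finset.sum_le_sum fun i _ => (hmain n i).2) ?_
  refine ENNReal.sum_lt_top.2 fun i _ => ENNReal.add_lt_top.2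
    ⟨ENNReal.mul_lt_top ?_ ENNReal.ofReal_lt_top, ENNReal.ofReal_lt_top⟩
  exact (measure_mono (Set.prod_mono Ioo_subset_Icc_self Ioo_subset_Icc_self)).trans_lt
    (isCompact_Icc.prod isCompact_Icc).measure_lt_top
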